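/- Corollary 1.1. Let $N\ge 3$ be an integer, $p_{\mathrm c}=\frac{N}{N-2}$, $p_{\mathrm S}=\frac{N+2}{N-2}$, $p_*=1+\frac{4}{N-4+2\sqrt{N-1}}$, and let $f(s)=s^p+s^r$ for $s>0$, where $p_{\mathrm c}<p<p_{\mathrm S}$ and $0<r<p$. Put $F(s)=\int_s^\infty \frac{d\eta}{f(\eta)}$ for $s>0$, $$a=\frac{4}{p-1}-N+2,\qquad D=\Bigl(N-2-\frac4{p-1}\Bigr)^2-8\Bigl(N-2-\frac2{p-1}\Bigr),$$ $\lambda_1=\frac{a-\sqrt D}{2}$ if $p<p_*$, and $\lambda_*=\frac{2}{p_*-1}-\frac{N-2}{2}$. For $0<\rho\le s$ let $$P(\rho,s)=\begin{cases}(\rho/s)^{\lambda_1}& p_{\mathrm c}<p<p_*,\\ \bigl(1+\log\frac s\rho\bigr)(\rho/s)^{\lambda_*}& p=p_*,\\ (\rho/s)^{a/2}& p_*<p<p_{\mathrm S}.\end{cases}$$ Let $$r^*=\begin{cases}\frac{p-1}{4}\bigl(N+2+\sqrt D\bigr)& p_{\mathrm c}<p<p_*,\\ \frac{(p-1)(N+2)}{4}&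 p_*\le p<p_{\mathrm S}.\end{cases}$$ Then the limit $q:=\lim_{s\to\infty}\frac{f'(s)^2}{f(s)f''(s)}$ exists and $\frac1p+\frac1q=1$. Moreover, there exist $r_0,\epsilon>0$ such that $\tilde u(\rho):=F^{-1}\bigl(\frac{\rho^2}{2N-4q}\bigr)$ is well defined for $0<\rho\le r_0$ (that is, $\frac{\rho^2}{2N-4q}\in F((0,\infty))$) and such that, for all $\alpha,\beta>0$ with $\alpha+\beta<\epsilon$, there is a radially symmetric singular solution $u$ of $-\Delta u=f(u)$ in $B_{r_0}\setminus\{0\}\subset\mathbb R^N$ (that is, $u\in C^2(B_{r_0}\setminus\{0\})$, $u>0$ and $-\Delta u=f(u)$ in $B_{r_0}\setminus\{0\}$, and $u(x)\to\infty$ as $x\to0$) of the form $$u(x)=\tilde u(|x|)\bigl(1+\theta(|x|)\bigr),\qquad 0<|x|<r_0,$$ where $\theta\in C^2((0,r_0))\cap C^1((0,r_0])\cap C([0,r_0])$ satisfies $\theta(r_0)=\alpha$, $r_0\theta'(r_0)=-\beta$ and, as $x\to0$, $$|\theta(|x|)|+|x||\theta'(|x|)|=O\left(\int_{|x|}^{r_0}P(|x|,s)\,\bigl|f'(\tilde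 u(s))F(\tilde u(s))-q\bigr|\,\frac{ds}{s}\right),$$ and also $|\theta(|x|)|+|x||\theta'(|x|)|=O(B(|x|))$ as $x\to 0$, where $B(\rho)$ is given by - if $0<r<r^*$: $\rho^{\lambda_1}$ for $p<p_*$, $\ \rho^{\lambda_*}\log\frac1\rho$ for $p=p_*$, $\ \rho^{a/2}$ for $p>p_*$; - if $r=r^*$: $\rho^{\lambda_1}\log\frac1\rho$ for $p<p_*$, $\ \rho^{\lambda_*}\bigl(\log\frac1\rho\bigr)^2$ for $p=p_*$, $\ \rho^{a/2}\log\frac1\rho$ for $p>p_*$; - if $r^*<r<p$: $\rho^{2(p-r)/(p-1)}$. -/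

import Mathlib

open Set Filter Topology Asymptotics

noncomputable section

namespace SingularElliptic

/-! Critical exponents (`N` is the space dimension). -/

/-- `p_c = N / (N - 2)`. -/
def pCrit (N : ℕ) : ℝ := (N : ℝ) / ((N : ℝ) - 2)

/-- `p_S = (N + 2) / (N - 2)`, the Sobolev exponent. -/
def pSobolev (N : ℕ) : ℝ := ((N : ℝ) + 2) / ((N : ℝ) - 2)

/-- `p_* = 1 + 4 / (N - 4 + 2 √(N - 1))`. -/
def pStar (N : ℕ) : ℝ := 1 + 4 / ((N : ℝ) - 4 + 2 * √((N : ℝ) - 1))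

/-! Coefficients and roots of `λ² + a λ + b = 0`, where `b = 2 N - 4 q` and `1/p + 1/q = 1`. -/

/-- `a = 4 / (p - 1) - N + 2`. -/
def coeffA (N : ℕ) (p : ℝ) : ℝ := 4 / (p - 1) - (N : ℝ) + 2

/-- The discriminant `a² - 4 b`, written out:
`(N - 2 - 4 / (p - 1))² - 8 (N - 2 - 2 / (p - 1))`. -/
def discr (N : ℕ) (p : ℝ) : ℝ :=
  ((N : ℝ) - 2 - 4 / (p - 1)) ^ 2 - 8 * ((N : ℝ) - 2 - 2 / (p - 1))

/-- For `p_c < p < p_*`, the number `-λ₁` is the larger (negative) root. -/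
def lam1 (N : ℕ) (p : ℝ) : ℝ := (coeffA N p - √(discr N p)) / 2

/-- For `p = p_*`, the number `-λ_*` is the double root. -/
def lamStar (N : ℕ) : ℝ := 2 / (pStar N - 1) - ((N : ℝ) - 2) / 2

/-- The threshold `r^*`, i.e. the value of `r` at which `2 (p - r) / (p - 1)` equals `λ₁`
(if `p < p_*`), respectively `a / 2` (if `p_* ≤ p`). -/
def rStar (N : ℕ) (p : ℝ) : ℝ :=
  if p < pStar N then (p - 1) / 4 * ((N : ℝ) + 2 + √(discr N p))
  else (p - 1) * ((N : ℝ) + 2) / 4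

/-- The kernel `P(ρ, s)`. -/
def kernelP (N : ℕ) (p ρ s : ℝ) : ℝ :=
  if p < pStar N then (ρ / s) ^ lam1 N p
  else if p = pStar N then (1 + Real.log (s / ρ)) * (ρ / s) ^ lamStar N
  else (ρ / s) ^ (coeffA N p / 2)

/-! The nonlinearity and the approximate solution. -/

/-- The nonlinearity `f(s) = s^p + s^r` (used for `s > 0` only). -/
def nonlin (p r s : ℝ) : ℝ := s ^ p + s ^ r

/-- `F(s) = ∫_s^∞ dη / f(η)`. -/
def tailInt (f : ℝ → ℝ) (s : ℝ) : ℝ := ∫ η in Ioi s, 1 / f η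

/-- `F⁻¹`, the inverse of `F : (0, ∞) → ℝ`; meaningful on the range `F((0, ∞))`. -/
def tailInv (f : ℝ → ℝ) : ℝ → ℝ := Function.invFunOn (tailInt f) (Ioi 0)

/-- `ũ(ρ) = F⁻¹(ρ² / (2 N - 4 q))`, as a function of the radius `ρ = |x|`. -/
def uTilde (N : ℕ) (q : ℝ) (f : ℝ → ℝ) (ρ : ℝ) : ℝ :=
  tailInv f (ρ ^ 2 / (2 * (N : ℝ) - 4 * q))

/-- `u` is a positive singular solution of `-Δ u = f(u)` in the punctured ball of radius `r₀`
centred at the origin of `ℝ^N`. -/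
structure IsSingularSolution (N : ℕ) (f : ℝ → ℝ) (r₀ : ℝ)
    (u : EuclideanSpace ℝ (Fin N) → ℝ) : Prop where
  contDiffOn : ContDiffOn ℝ 2 u (Metric.ball 0 r₀ \ {0})
  pos : ∀ x ∈ Metric.ball (0 : EuclideanSpace ℝ (Fin N)) r₀ \ {0}, 0 < u x
  eqn : ∀ x ∈ Metric.ball (0 : EuclideanSpace ℝ (Fin N)) r₀ \ {0},
    -(Laplacian.laplacian u x) = f (u x)
  singular : Tendsto u (𝓝[≠] 0) atTop

/-- The explicit comparison function, evaluated at `ρ = |x|`. -/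
def decayBound (N : ℕ) (p r ρ : ℝ) : ℝ :=
  if r < rStar N p then
    if p < pStar N then ρ ^ lam1 N p
    else if p = pStar N then ρ ^ lamStar N * Real.log (1 / ρ)
    else ρ ^ (coeffA N p / 2)
  else if r = rStar N p then
    if p < pStar N then ρ ^ lam1 N p * Real.log (1 / ρ)
    else if p = pStar N then ρ ^ lamStar N * Real.log (1 / ρ) ^ 2
    else ρ ^ (coeffA N p / 2) * Real.log (1 / ρ)
  else ρ ^ (2 * (p - r) / (p - 1))

end SingularElliptic

end

open SingularElliptic

/-! In the logarithmic time t = log(r₀/ρ), the ansatz u = ũ(1+θ) turns the radial equation into a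
damped linear oscillator with a small perturbation. Since F(ũ) = ρ²/b with b = 2N - 4q, every
derivative of ũ is expressed through f(ũ), f'(ũ) and F(ũ). The result is θ'' + aθ' + bθ = g(t, θ,
θ'), with g given by `perturbation` (`radial_equation_of_perturbation`). The linear coefficients in
g measure the deviation of f from s^p. They are O(ũ^(r-p)) = O(e^(-μt)) with μ = 2(p-r)/(p-1). The
other θ-dependent terms are quadratically small, and at θ = θ' = 0 only a multiple of h = f'(ũ)F(ũ)
- q survives.

The condition p > p_c gives b > 0 and p < p_S gives a > 0, so every linear mode decays as t → ∞. The
sign of a² - 4b separates p < p_*, p = p_* and p > p_*. In each case the fundamental solution is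
bounded by K(t) = (1+jt)e^(-lt), and P(ρ,s) is K at t = log(s/ρ) (`kernelP_eq`).

The equation is solved by variation of constants and a contraction
(`exists_solution_of_weighted_contraction`) in a norm weighted by A = δK + K*H, where H = |h|. This
is the size of what the initial data and the source produce. Because K is almost multiplicative,
K(t-s)A(s) ≤ (1+s)A(t), so convolving K with an exponentially decaying Lipschitz constant times A
returns a multiple of A (`integral_decayKernel_mul_decayWeight_le`). That multiple is made small
through the factor r₀^μ. The fixed point satisfies |θ| + |θ'| = O(A).

Both decay estimates are read off from A. For the integral bound, δK is absorbed into K*H because h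
is not identically zero (`exists_holderDefect_ne_zero`, `exists_decayKernel_le_decayConv`), and K*H
is the integral of P against |h| (`integral_kernelP_eq`). For the explicit bound, H = O(e^(-μt)) is
inserted: the cases μ > l, μ = l and μ < l of the convolution are r < r*, r = r* and r > r*
(`decayWeight_isBigO_decayBound`). -/

namespace SingularElliptic

/-! Variation of constants for `y'' + a y' + b y = G`. -/

/-- `k` solves `k'' + a k' + b k = 0` with `k 0 = 0` and `k' 0 = 1`. -/
structure IsFundamentalSolution (a b : ℝ) (k k' : ℝ → ℝ) : Prop where
  hasDerivAt : ∀ t, HasDerivAt k (k' t) t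
  hasDerivAt' : ∀ t, HasDerivAt k' (-a * k' t - b * k t) t
  zero : k 0 = 0
  deriv_zero : k' 0 = 1

namespace IsFundamentalSolution

variable {a b : ℝ} {k k' : ℝ → ℝ}

lemma continuous (h : IsFundamentalSolution a b k k') : Continuous k :=
  continuous_iff_continuousAt.2 fun t => (h.hasDerivAt t).continuousAt

lemma continuous' (h : IsFundamentalSolution a b k k') : Continuous k' :=
  continuous_iff_continuousAt.2 fun t => (h.hasDerivAt' t).continuousAt

/-- The expression with s replaced by s + t - σ and t by σ does not depend on σ; compare σ = 0 with
σ = t. -/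
lemma add (h : IsFundamentalSolution a b k k') (s t : ℝ) :
    k (s + t) = k s * (k' t + a * k t) + k' s * k t := by
  have key : ∀ σ, HasDerivAt
      (fun σ => k (s + t - σ) * (k' σ + a * k σ) + k' (s + t - σ) * k σ) 0 σ := by
    intro σ
    have hsub : HasDerivAt (fun σ => s + t - σ) (-1) σ := by
      simpa using (hasDerivAt_id σ).const_sub (s + t)
    have h1 := (h.hasDerivAt (s + t - σ)).comp σ hsub
    have h2 := (h.hasDerivAt' (s + t - σ)).comp σ hsub
    have h3 := (h1.mul ((h.hasDerivAt' σ).add ((h.hasDerivAt σ).const_mul a))).add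
      (h2.mul (h.hasDerivAt σ))
    refine h3.congr_deriv ?_
    simp only [Function.comp, Pi.add_apply]
    ring
  have hc := is_const_of_deriv_eq_zero (fun σ => (key σ).differentiableAt)
    (fun σ => (key σ).deriv) 0 t
  simpa [h.zero, h.deriv_zero] using hc

lemma add' (h : IsFundamentalSolution a b k k') (s t : ℝ) :
    k' (s + t) = k' s * (k' t + a * k t) + (-a * k' s - b * k s) * k t := by
  have h1 : HasDerivAt (fun s => k (s + t)) (k' (s + t)) s := by
    simpa using (h.hasDerivAt (s + t)).comp_add_const s t
  have h2 := ((h.hasDerivAt s).mul_const (k' t + a * k t)).add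
    ((h.hasDerivAt' s).mul_const (k t))
  have h3 : (fun s => k (s + t)) = fun s => k s * (k' t + a * k t) + k' s * k t :=
    funext fun s => h.add s t
  rw [h3] at h1
  exact h1.unique h2

/-- The solution of `y'' + a y' + b y = G`, `y 0 = α`, `y' 0 = β`. -/
noncomputable def duhamel (_h : IsFundamentalSolution a b k k') (α β : ℝ) (G : ℝ → ℝ) (t : ℝ) : ℝ :=
  α * (k' t + a * k t) + β * k t + ∫ s in (0 : ℝ)..t, k (t - s) * G s

/-- The derivative of `duhamel`. -/
noncomputable def duhamel' (_h : IsFundamentalSolution a b k k') (α β : ℝ) (G : ℝ → ℝ)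
    (t : ℝ) : ℝ :=
  α * (-b * k t) + β * k' t + ∫ s in (0 : ℝ)..t, k' (t - s) * G s

variable {α β : ℝ} {G : ℝ → ℝ}

lemma hasDerivAt_duhamel_aux (h : IsFundamentalSolution a b k k') (hG : Continuous G) (t : ℝ) :
    HasDerivAt (h.duhamel α β G) (h.duhamel' α β G t) t ∧
      HasDerivAt (h.duhamel' α β G)
        (G t - a * h.duhamel' α β G t - b * h.duhamel α β G t) t := by
  -- The addition formula separates t from s in k(t - s). The variable t then leaves the integrand,
  -- and the fundamental theorem of calculus replaces differentiation under the integral sign.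
  set c₁ : ℝ → ℝ := fun s => (k' (-s) + a * k (-s)) * G s with hc₁
  set c₂ : ℝ → ℝ := fun s => k (-s) * G s with hc₂
  have hk := h.continuous
  have hk' := h.continuous'
  have hc₁' : Continuous c₁ := by fun_prop
  have hc₂' : Continuous c₂ := by fun_prop
  have e1 : ∀ t, ∫ s in (0 : ℝ)..t, k (t - s) * G s =
      k t * (∫ s in (0 : ℝ)..t, c₁ s) + k' t * ∫ s in (0 : ℝ)..t, c₂ s := by
    intro t
    rw [← intervalIntegral.integral_const_mul, ← intervalIntegral.integral_const_mul,
      ← intervalIntegral.integral_add ((hc₁'.const_mul _).intervalIntegrable _ _)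
        ((hc₂'.const_mul _).intervalIntegrable _ _)]
    congr 1
    ext s
    rw [sub_eq_add_neg, h.add t (-s), hc₁, hc₂]
    ring
  have e2 : ∀ t, ∫ s in (0 : ℝ)..t, k' (t - s) * G s =
      k' t * (∫ s in (0 : ℝ)..t, c₁ s) + (-a * k' t - b * k t) * ∫ s in (0 : ℝ)..t, c₂ s := by
    intro t
    rw [← intervalIntegral.integral_const_mul, ← intervalIntegral.integral_const_mul,
      ← intervalIntegral.integral_add ((hc₁'.const_mul _).intervalIntegrable _ _)
        ((hc₂'.const_mul _).intervalIntegrable _ _)]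
    congr 1
    ext s
    rw [sub_eq_add_neg, h.add' t (-s), hc₁, hc₂]
    ring
  have d1 : HasDerivAt (fun t => ∫ s in (0 : ℝ)..t, c₁ s) (c₁ t) t :=
    (hc₁'.integral_hasStrictDerivAt 0 t).hasDerivAt
  have d2 : HasDerivAt (fun t => ∫ s in (0 : ℝ)..t, c₂ s) (c₂ t) t :=
    (hc₂'.integral_hasStrictDerivAt 0 t).hasDerivAt
  -- These are k(0) = 0 and k'(0) = 1: the boundary term drops out of the first derivative and
  -- contributes exactly G(t) to the second.
  have z1 : k t * (k' (-t) + a * k (-t)) + k' t * k (-t) = 0 := by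
    rw [← h.add, add_neg_cancel, h.zero]
  have z2 : k' t * (k' (-t) + a * k (-t)) + (-a * k' t - b * k t) * k (-t) = 1 := by
    rw [← h.add', add_neg_cancel, h.deriv_zero]
  have f1 : h.duhamel α β G = fun t => α * (k' t + a * k t) + β * k t +
      (k t * (∫ s in (0 : ℝ)..t, c₁ s) + k' t * ∫ s in (0 : ℝ)..t, c₂ s) := by
    ext t; rw [duhamel, e1]
  have f2 : h.duhamel' α β G = fun t => α * (-b * k t) + β * k' t +
      (k' t * (∫ s in (0 : ℝ)..t, c₁ s) + (-a * k' t - b * k t) * ∫ s in (0 : ℝ)..t, c₂ s) := by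
    ext t; rw [duhamel', e2]
  rw [f1, f2]
  have hd := h.hasDerivAt t
  have hd' := h.hasDerivAt' t
  constructor
  · refine ((((hd'.add (hd.const_mul a)).const_mul α).add (hd.const_mul β)).add
      ((hd.mul d1).add (hd'.mul d2))).congr_deriv ?_
    simp only [hc₁, hc₂]
    linear_combination G t * z1
  · refine ((((hd.const_mul (-b)).const_mul α).add (hd'.const_mul β)).add
      ((hd'.mul d1).add (((hd'.const_mul (-a)).sub (hd.const_mul b)).mul d2))).congr_deriv ?_
    simp only [hc₁, hc₂, Pi.sub_apply]
    linear_combination G t * z2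

lemma hasDerivAt_duhamel (h : IsFundamentalSolution a b k k') (hG : Continuous G) (t : ℝ) :
    HasDerivAt (h.duhamel α β G) (h.duhamel' α β G t) t :=
  (h.hasDerivAt_duhamel_aux hG t).1

lemma hasDerivAt_duhamel' (h : IsFundamentalSolution a b k k') (hG : Continuous G) (t : ℝ) :
    HasDerivAt (h.duhamel' α β G)
      (G t - a * h.duhamel' α β G t - b * h.duhamel α β G t) t :=
  (h.hasDerivAt_duhamel_aux hG t).2

lemma continuous_duhamel (h : IsFundamentalSolution a b k k') (hG : Continuous G) :
    Continuous (h.duhamel α β G) :=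
  continuous_iff_continuousAt.2 fun t => (h.hasDerivAt_duhamel hG t).continuousAt

lemma continuous_duhamel' (h : IsFundamentalSolution a b k k') (hG : Continuous G) :
    Continuous (h.duhamel' α β G) :=
  continuous_iff_continuousAt.2 fun t => (h.hasDerivAt_duhamel' hG t).continuousAt

end IsFundamentalSolution

/-! ### Contraction in a weighted space. -/

lemma abs_convolution_sub_le {k K G₁ G₂ B : ℝ → ℝ} {C t : ℝ} (ht : 0 ≤ t)
    (hk : Continuous k) (hK : Continuous K) (hG₁ : Continuous G₁) (hG₂ : Continuous G₂)
    (hB : Continuous B) (hkK : ∀ s, 0 ≤ s → |k s| ≤ C * K s)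
    (hG : ∀ s, 0 ≤ s → |G₁ s - G₂ s| ≤ B s) :
    |(∫ s in (0 : ℝ)..t, k (t - s) * G₁ s) - ∫ s in (0 : ℝ)..t, k (t - s) * G₂ s| ≤
      C * ∫ s in (0 : ℝ)..t, K (t - s) * B s := by
  rw [← intervalIntegral.integral_sub (Continuous.intervalIntegrable (by fun_prop) _ _)
    (Continuous.intervalIntegrable (by fun_prop) _ _), ← intervalIntegral.integral_const_mul,
    ← Real.norm_eq_abs]
  refine intervalIntegral.norm_integral_le_of_norm_le ht (Eventually.of_forall fun s hs => ?_)
    (Continuous.intervalIntegrable (by fun_prop) _ _)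
  rw [← mul_sub, Real.norm_eq_abs, abs_mul, ← mul_assoc]
  exact mul_le_mul (hkK _ (by linarith [hs.2])) (hG s hs.1.le) (abs_nonneg _)
    ((abs_nonneg _).trans (hkK _ (by linarith [hs.2])))

open BoundedContinuousFunction in
/-- Global solvability of `y'' + a y' + b y = g (t, y, y')` on `[0, ∞)` with the decay rate
prescribed by the weight `A`. -/
theorem exists_solution_of_weighted_contraction {a b C M α β : ℝ} {k k' K A L H : ℝ → ℝ}
    {g : ℝ → ℝ → ℝ → ℝ} (h : IsFundamentalSolution a b k k')
    (hK : Continuous K) (hkK : ∀ t, 0 ≤ t → |k t| ≤ C * K t)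
    (hkK' : ∀ t, 0 ≤ t → |k' t| ≤ C * K t)
    (hA : Continuous A) (hA0 : ∀ t, 0 < A t) (hL : Continuous L) (hH : Continuous H)
    (hg : Continuous fun z : ℝ × ℝ × ℝ => g z.1 z.2.1 z.2.2)
    (hgL : ∀ t, 0 ≤ t → ∀ x y x' y', |g t x y - g t x' y'| ≤ L t * max |x - x'| |y - y'|)
    (hL0 : ∀ t, 0 ≤ t → 0 ≤ L t)
    (hgH : ∀ t, 0 ≤ t → |g t 0 0| ≤ H t)
    (hφ : ∀ t, 0 ≤ t → |α * (k' t + a * k t) + β * k t| ≤ M / 4 * A t)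
    (hφ' : ∀ t, 0 ≤ t → |α * (-b * k t) + β * k' t| ≤ M / 4 * A t)
    (hCH : ∀ t, 0 ≤ t → C * ∫ s in (0 : ℝ)..t, K (t - s) * H s ≤ M / 4 * A t)
    (hCL : ∀ t, 0 ≤ t → C * ∫ s in (0 : ℝ)..t, K (t - s) * (L s * A s) ≤ 1 / 2 * A t) :
    ∃ θ η ζ : ℝ → ℝ, (∀ t, HasDerivAt θ (η t) t) ∧ (∀ t, HasDerivAt η (ζ t) t) ∧
      Continuous ζ ∧ (∀ t, 0 ≤ t → ζ t + a * η t + b * θ t = g t (θ t) (η t)) ∧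
      θ 0 = α ∧ η 0 = β ∧ ∀ t, 0 ≤ t → |θ t| ≤ M * A t ∧ |η t| ≤ M * A t := by
  have hk := h.continuous
  have hk' := h.continuous'
  -- The unknown v stands for (θ, θ') / A, so the sup norm of v is the weighted norm.
  set S : (ℝ →ᵇ ℝ × ℝ) → ℝ → ℝ := fun v s => g s (A s * (v s).1) (A s * (v s).2) with hS
  have hSc : ∀ v, Continuous (S v) := fun v =>
    hg.comp (continuous_id.prodMk ((hA.mul v.continuous.fst).prodMk (hA.mul v.continuous.snd)))
  have hSsub : ∀ v w s, 0 ≤ s → |S v s - S w s| ≤ ‖v - w‖ * (L s * A s) := by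
    intro v w s hs
    refine (hgL s hs _ _ _ _).trans ?_
    rw [mul_comm, mul_comm (L s), ← mul_assoc]
    refine mul_le_mul_of_nonneg_right ?_ (hL0 s hs)
    have hvw := (v - w).norm_coe_le_norm s
    rw [Prod.norm_def] at hvw
    simp only [BoundedContinuousFunction.coe_sub, Pi.sub_apply, Prod.fst_sub, Prod.snd_sub,
      Real.norm_eq_abs] at hvw
    rw [← mul_sub, ← mul_sub, abs_mul, abs_mul, abs_of_pos (hA0 s), mul_comm ‖v - w‖]
    refine max_le ?_ ?_
    · exact mul_le_mul_of_nonneg_left ((le_max_left _ _).trans hvw) (hA0 s).le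
    · exact mul_le_mul_of_nonneg_left ((le_max_right _ _).trans hvw) (hA0 s).le
  have hint : ∀ c t, C * ∫ s in (0 : ℝ)..t, K (t - s) * (c * (L s * A s)) =
      c * (C * ∫ s in (0 : ℝ)..t, K (t - s) * (L s * A s)) := by
    intro c t
    rw [mul_left_comm c C, ← intervalIntegral.integral_const_mul c]
    congr 2; ext s; ring
  have hd : ∀ (κ : ℝ → ℝ), Continuous κ → (∀ t, 0 ≤ t → |κ t| ≤ C * K t) → ∀ v w t, 0 ≤ t →
      |(∫ s in (0 : ℝ)..t, κ (t - s) * S v s) - ∫ s in (0 : ℝ)..t, κ (t - s) * S w s| ≤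
        ‖v - w‖ * (1 / 2 * A t) := by
    intro κ hκ hκK v w t ht
    refine (abs_convolution_sub_le ht hκ hK (hSc v) (hSc w)
      (B := fun s => ‖v - w‖ * (L s * A s)) (by fun_prop) hκK (hSsub v w)).trans ?_
    rw [hint]
    exact mul_le_mul_of_nonneg_left (hCL t ht) (norm_nonneg _)
  have hzero : ∀ (κ : ℝ → ℝ), Continuous κ → (∀ t, 0 ≤ t → |κ t| ≤ C * K t) → ∀ t, 0 ≤ t →
      |∫ s in (0 : ℝ)..t, κ (t - s) * S 0 s| ≤ M / 4 * A t := by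
    intro κ hκ hκK t ht
    have := abs_convolution_sub_le ht hκ hK (hSc 0) (continuous_const (y := (0 : ℝ))) hH hκK
      (fun s hs => by simpa [hS] using hgH s hs)
    simp only [mul_zero, intervalIntegral.integral_zero, sub_zero] at this
    exact this.trans (hCH t ht)
  have hM : 0 ≤ M := by
    have h1 := (abs_nonneg _).trans (hφ 0 le_rfl)
    have := nonneg_of_mul_nonneg_left h1 (hA0 0)
    linarith
  -- The budget: M/4 for the initial data, M/4 for the source at v = 0, and half of the norm of v
  -- for the Lipschitz part. A fixed point therefore has norm at most M.
  have hb : ∀ v t, 0 ≤ t → |h.duhamel α β (S v) t| ≤ (M / 2 + 1 / 2 * ‖v‖) * A t := by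
    intro v t ht
    have h1 := hd k hk hkK v 0 t ht
    have h2 := hzero k hk hkK t ht
    have h3 := hφ t ht
    rw [sub_zero] at h1
    rw [IsFundamentalSolution.duhamel]
    rw [abs_le] at *
    constructor <;> linarith
  have hb' : ∀ v t, 0 ≤ t → |h.duhamel' α β (S v) t| ≤ (M / 2 + 1 / 2 * ‖v‖) * A t := by
    intro v t ht
    have h1 := hd k' hk' hkK' v 0 t ht
    have h2 := hzero k' hk' hkK' t ht
    have h3 := hφ' t ht
    rw [sub_zero] at h1
    rw [IsFundamentalSolution.duhamel']
    rw [abs_le] at *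
    constructor <;> linarith
  have hpos : ∀ t : ℝ, 0 ≤ max t 0 := fun t => le_max_right _ _
  -- Evaluating at `max t 0` freezes the image for t < 0, where no estimates are available, and
  -- keeps it bounded on the whole line.
  let T : (ℝ →ᵇ ℝ × ℝ) → (ℝ →ᵇ ℝ × ℝ) := fun v =>
    BoundedContinuousFunction.ofNormedAddCommGroup
      (fun t => (h.duhamel α β (S v) (max t 0) / A (max t 0),
        h.duhamel' α β (S v) (max t 0) / A (max t 0)))
      (by
        have c1 := h.continuous_duhamel (α := α) (β := β) (hSc v)
        have c2 := h.continuous_duhamel' (α := α) (β := β) (hSc v)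
        have c3 : Continuous fun t : ℝ => max t 0 := by fun_prop
        exact ((c1.comp c3).div (hA.comp c3) fun t => (hA0 _).ne').prodMk
          ((c2.comp c3).div (hA.comp c3) fun t => (hA0 _).ne'))
      (M / 2 + 1 / 2 * ‖v‖)
      (fun t => by
        rw [Prod.norm_def, Real.norm_eq_abs, Real.norm_eq_abs, abs_div, abs_div,
          abs_of_pos (hA0 _)]
        exact max_le ((div_le_iff₀ (hA0 _)).2 (hb v _ (hpos t)))
          ((div_le_iff₀ (hA0 _)).2 (hb' v _ (hpos t))))
  have hT : ∀ v t, T v t = (h.duhamel α β (S v) (max t 0) / A (max t 0),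
        h.duhamel' α β (S v) (max t 0) / A (max t 0)) := fun v t => rfl
  have hTn : ∀ v, ‖T v‖ ≤ M / 2 + 1 / 2 * ‖v‖ := fun v =>
    BoundedContinuousFunction.norm_ofNormedAddCommGroup_le _ (by positivity) _
  have hcon : ContractingWith (1 / 2) T := by
    refine ⟨by rw [← NNReal.coe_lt_coe]; norm_num, LipschitzWith.of_dist_le_mul fun v w => ?_⟩
    rw [dist_eq_norm v w]
    refine (BoundedContinuousFunction.dist_le (by positivity)).2 fun t => ?_
    rw [hT, hT, Prod.dist_eq, Real.dist_eq, Real.dist_eq, ← sub_div, ← sub_div, abs_div, abs_div,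
      abs_of_pos (hA0 _)]
    have e : ((1 / 2 : NNReal) : ℝ) * ‖v - w‖ * A (max t 0) = ‖v - w‖ * (1 / 2 * A (max t 0)) := by
      push_cast; ring
    refine max_le ((div_le_iff₀ (hA0 _)).2 ?_) ((div_le_iff₀ (hA0 _)).2 ?_) <;> rw [e]
    · simpa [IsFundamentalSolution.duhamel] using hd k hk hkK v w _ (hpos t)
    · simpa [IsFundamentalSolution.duhamel'] using hd k' hk' hkK' v w _ (hpos t)
  obtain ⟨v, hv⟩ : ∃ v, T v = v := ⟨_, hcon.fixedPoint_isFixedPt⟩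
  have hvM : ‖v‖ ≤ M := by
    have := hTn v
    rw [hv] at this
    linarith
  have hfix : ∀ t, 0 ≤ t → h.duhamel α β (S v) t = A t * (v t).1 ∧
      h.duhamel' α β (S v) t = A t * (v t).2 := by
    intro t ht
    have h1 := hT v t
    rw [hv, max_eq_left ht] at h1
    rw [h1]
    constructor <;> simp only <;> rw [mul_div_cancel₀ _ (hA0 t).ne']
  -- The Duhamel formula is returned rather than A v: it is differentiable on all of ℝ and agrees
  -- with A v for t ≥ 0.
  refine ⟨h.duhamel α β (S v), h.duhamel' α β (S v), _, h.hasDerivAt_duhamel (hSc v),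
    h.hasDerivAt_duhamel' (hSc v), ?_, ?_, ?_, ?_, ?_⟩
  · have c1 := h.continuous_duhamel (α := α) (β := β) (hSc v)
    have c2 := h.continuous_duhamel' (α := α) (β := β) (hSc v)
    have c3 := hSc v
    fun_prop
  · intro t ht
    obtain ⟨h1, h2⟩ := hfix t ht
    have e : S v t = g t (h.duhamel α β (S v) t) (h.duhamel' α β (S v) t) := by rw [h1, h2]
    rw [← e]
    ring
  · simp [IsFundamentalSolution.duhamel, h.zero, h.deriv_zero]
  · simp [IsFundamentalSolution.duhamel', h.zero, h.deriv_zero]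
  · intro t ht
    have e : (M / 2 + 1 / 2 * ‖v‖) * A t ≤ M * A t :=
      mul_le_mul_of_nonneg_right (by linarith) (hA0 t).le
    exact ⟨(hb v t ht).trans e, (hb' v t ht).trans e⟩

/-! ### Explicit fundamental solutions in the three discriminant regimes. -/

/-- The decay rate `(1 + j t) e^{-λ t}`. -/
noncomputable def decayKernel (j l t : ℝ) : ℝ := (1 + j * t) * Real.exp (-(l * t))

lemma hasDerivAt_exp_neg_mul (l t : ℝ) :
    HasDerivAt (fun t => Real.exp (-(l * t))) (-l * Real.exp (-(l * t))) t := by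
  refine (((hasDerivAt_id t).const_mul l).neg.exp).congr_deriv ?_
  simp only [id, mul_one, Pi.neg_apply]
  ring

/-- Two real modes, of which the slower sets the rate; positivity of b makes √(a² - 4b) < a, so this
mode decays too. -/
lemma exists_fundamentalSolution_of_pos {a b : ℝ} (ha : 0 < a) (hb : 0 < b)
    (hD : 0 < a ^ 2 - 4 * b) :
    ∃ (k k' : ℝ → ℝ) (C : ℝ), 0 < C ∧ IsFundamentalSolution a b k k' ∧ ∀ t, 0 ≤ t →
      |k t| ≤ C * decayKernel 0 ((a - √(a ^ 2 - 4 * b)) / 2) t ∧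
      |k' t| ≤ C * decayKernel 0 ((a - √(a ^ 2 - 4 * b)) / 2) t := by
  set d := √(a ^ 2 - 4 * b) with hd
  have hd0 : 0 < d := Real.sqrt_pos.2 hD
  have hd2 : d ^ 2 = a ^ 2 - 4 * b := Real.sq_sqrt hD.le
  have hda : d < a := by nlinarith
  set l := (a - d) / 2 with hl
  set m := (a + d) / 2 with hm
  have hl0 : 0 < l := by rw [hl]; linarith
  have hlm : l < m := by rw [hl, hm]; linarith
  have hml : m - l = d := by rw [hl, hm]; ring
  have hsum : l + m = a := by rw [hl, hm]; ring
  have hprod : l * m = b := by rw [hl, hm]; linear_combination -hd2 / 4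
  refine ⟨fun t => (Real.exp (-(l * t)) - Real.exp (-(m * t))) / d,
    fun t => (m * Real.exp (-(m * t)) - l * Real.exp (-(l * t))) / d, (1 + m) / d,
    div_pos (by linarith) hd0, ⟨fun t => ?_, fun t => ?_, by simp, ?_⟩, fun t ht => ?_⟩
  · refine (((hasDerivAt_exp_neg_mul l t).sub (hasDerivAt_exp_neg_mul m t)).div_const d).congr_deriv
      ?_
    ring
  · refine ((((hasDerivAt_exp_neg_mul m t).const_mul m).sub
      ((hasDerivAt_exp_neg_mul l t).const_mul l)).div_const d).congr_deriv ?_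
    rw [← hsum, ← hprod]
    ring
  · simp [hml, hd0.ne']
  · have h1 : Real.exp (-(m * t)) ≤ Real.exp (-(l * t)) :=
      Real.exp_le_exp.2 (neg_le_neg (mul_le_mul_of_nonneg_right hlm.le ht))
    have h2 := Real.exp_pos (-(m * t))
    have h3 := Real.exp_pos (-(l * t))
    have e : (1 + m) / d * decayKernel 0 l t = (1 + m) * Real.exp (-(l * t)) / d := by
      rw [decayKernel]; ring
    rw [e, abs_div, abs_div, abs_of_pos hd0]
    have hm0 : 0 < m := hl0.trans hlm
    constructor <;> refine div_le_div_of_nonneg_right (abs_le.2 ⟨?_, ?_⟩) hd0.le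
    · nlinarith [mul_pos hm0 h3]
    · nlinarith [mul_pos hm0 h3]
    · nlinarith [mul_pos hm0 h3, mul_pos hm0 h2, mul_le_mul_of_nonneg_right hlm.le h3.le]
    · nlinarith [mul_pos hm0 h3, mul_pos hl0 h3, mul_le_mul_of_nonneg_left h1 hm0.le]

/-- The double root produces t e^(-lt), the only regime that needs the linear factor j = 1. -/
lemma exists_fundamentalSolution_of_eq {a b : ℝ} (ha : 0 < a) (hD : a ^ 2 - 4 * b = 0) :
    ∃ (k k' : ℝ → ℝ) (C : ℝ), 0 < C ∧ IsFundamentalSolution a b k k' ∧ ∀ t, 0 ≤ t →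
      |k t| ≤ C * decayKernel 1 (a / 2) t ∧ |k' t| ≤ C * decayKernel 1 (a / 2) t := by
  obtain ⟨l, rfl⟩ : ∃ l, a = 2 * l := ⟨a / 2, by ring⟩
  have hl0 : 0 < l := by linarith
  have hb : b = l ^ 2 := by linarith
  subst hb
  refine ⟨fun t => t * Real.exp (-(l * t)), fun t => (1 - l * t) * Real.exp (-(l * t)), 1 + l,
    by positivity, ⟨fun t => ?_, fun t => ?_, by simp, by simp⟩, fun t ht => ?_⟩
  · refine ((hasDerivAt_id t).mul (hasDerivAt_exp_neg_mul l t)).congr_deriv ?_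
    simp only [id]
    ring
  · refine ((((hasDerivAt_id t).const_mul l).const_sub 1).mul
      (hasDerivAt_exp_neg_mul l t)).congr_deriv ?_
    simp only [id]
    ring
  · have h3 := Real.exp_pos (-(l * t))
    have hlt : 0 ≤ l * t := by positivity
    rw [mul_div_cancel_left₀ _ two_ne_zero, decayKernel, abs_mul, abs_mul, abs_of_pos h3,
      ← mul_assoc]
    constructor <;> refine mul_le_mul_of_nonneg_right (abs_le.2 ⟨?_, ?_⟩) h3.le <;> nlinarith

/-- The modes oscillate; the frequency enters the constant only, and the envelope is e^(-at/2). -/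
lemma exists_fundamentalSolution_of_neg {a b : ℝ} (ha : 0 < a) (hD : a ^ 2 - 4 * b < 0) :
    ∃ (k k' : ℝ → ℝ) (C : ℝ), 0 < C ∧ IsFundamentalSolution a b k k' ∧ ∀ t, 0 ≤ t →
      |k t| ≤ C * decayKernel 0 (a / 2) t ∧ |k' t| ≤ C * decayKernel 0 (a / 2) t := by
  obtain ⟨l, rfl⟩ : ∃ l, a = 2 * l := ⟨a / 2, by ring⟩
  have hl0 : 0 < l := by linarith
  obtain ⟨w, hw0, hw⟩ : ∃ w, 0 < w ∧ w ^ 2 = b - l ^ 2 :=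
    ⟨√(b - l ^ 2), Real.sqrt_pos.2 (by linarith), Real.sq_sqrt (by linarith)⟩
  obtain rfl : b = l ^ 2 + w ^ 2 := by linarith
  have hs : ∀ t, HasDerivAt (fun t => Real.sin (w * t)) (w * Real.cos (w * t)) t := fun t => by
    refine (((hasDerivAt_id t).const_mul w).sin).congr_deriv ?_
    simp only [id]; ring
  have hc : ∀ t, HasDerivAt (fun t => Real.cos (w * t)) (-w * Real.sin (w * t)) t := fun t => by
    refine (((hasDerivAt_id t).const_mul w).cos).congr_deriv ?_
    simp only [id]; ring
  refine ⟨fun t => Real.exp (-(l * t)) * (Real.sin (w * t) / w),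
    fun t => Real.exp (-(l * t)) * (Real.cos (w * t) - l * (Real.sin (w * t) / w)),
    1 + (1 + l) / w, by positivity, ⟨fun t => ?_, fun t => ?_, by simp, by simp⟩, fun t ht => ?_⟩
  · refine ((hasDerivAt_exp_neg_mul l t).mul ((hs t).div_const w)).congr_deriv ?_
    field_simp
    ring
  · refine ((hasDerivAt_exp_neg_mul l t).mul ((hc t).sub
      (((hs t).div_const w).const_mul l))).congr_deriv ?_
    simp only [Pi.sub_apply]
    field_simp
    ring
  · have h3 := Real.exp_pos (-(l * t))
    have h1 : |Real.sin (w * t) / w| ≤ 1 / w := by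
      rw [abs_div, abs_of_pos hw0]
      exact div_le_div_of_nonneg_right (Real.abs_sin_le_one _) hw0.le
    have h2 := Real.abs_cos_le_one (w * t)
    have h4 : |Real.cos (w * t) - l * (Real.sin (w * t) / w)| ≤ 1 + l * (1 / w) := by
      refine (abs_sub _ _).trans (add_le_add h2 ?_)
      rw [abs_mul, abs_of_pos hl0]
      exact mul_le_mul_of_nonneg_left h1 hl0.le
    have e : (1 + l) / w = 1 / w + l * (1 / w) := by ring
    have h5 : 0 < 1 / w := by positivity
    rw [mul_div_cancel_left₀ _ two_ne_zero, decayKernel, abs_mul, abs_mul, abs_of_pos h3,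
      zero_mul, add_zero, one_mul, mul_comm _ (Real.exp _)]
    constructor <;> refine mul_le_mul_of_nonneg_left ?_ h3.le
    · nlinarith
    · linarith

/-! Convolution with `decayKernel`. -/

variable {j l : ℝ}

lemma continuous_decayKernel : Continuous (decayKernel j l) := by
  unfold decayKernel
  fun_prop

lemma decayKernel_pos (hj : 0 ≤ j) {t : ℝ} (ht : 0 ≤ t) : 0 < decayKernel j l t := by
  unfold decayKernel
  positivity

/-- Exponentials multiply exactly. Of the two linear factors, the one in t is absorbed by the factor
in t + s, and the one in s is the whole loss, independent of t. The free bound u lets s be a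
difference later. -/
lemma decayKernel_mul_le (hj : 0 ≤ j) (hj1 : j ≤ 1) {s t : ℝ} (hs : 0 ≤ s) (ht : 0 ≤ t) {u : ℝ}
    (hu : s ≤ u) :
    decayKernel j l t * decayKernel j l s ≤ (1 + u) * decayKernel j l (t + s) := by
  unfold decayKernel
  have e : Real.exp (-(l * (t + s))) = Real.exp (-(l * t)) * Real.exp (-(l * s)) := by
    rw [← Real.exp_add]; congr 1; ring
  have h1 : 1 + j * t ≤ 1 + j * (t + s) := by nlinarith
  have h2 : 1 + j * s ≤ 1 + u := by nlinarith
  have h3 : (1 + j * t) * (1 + j * s) ≤ (1 + j * (t + s)) * (1 + u) :=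
    mul_le_mul h1 h2 (by positivity) (by positivity)
  have h4 := mul_le_mul_of_nonneg_right h3
    (mul_pos (Real.exp_pos (-(l * t))) (Real.exp_pos (-(l * s)))).le
  rw [e]
  linarith

/-- `∫₀ᵗ K(t - s) H(s) ds` for `K = decayKernel j l`. -/
noncomputable def decayConv (j l : ℝ) (H : ℝ → ℝ) (t : ℝ) : ℝ :=
  ∫ s in (0 : ℝ)..t, decayKernel j l (t - s) * H s

variable {H : ℝ → ℝ}

lemma continuous_decayConv (hH : Continuous H) : Continuous (decayConv j l H) := by
  unfold decayConv
  have := continuous_decayKernel (j := j) (l := l)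
  exact intervalIntegral.continuous_parametric_intervalIntegral_of_continuous
    (f := fun t s => decayKernel j l (t - s) * H s) (by fun_prop) continuous_id

lemma continuous_decayConv_integrand (hH : Continuous H) (t : ℝ) :
    Continuous fun s => decayKernel j l (t - s) * H s := by
  have := continuous_decayKernel (j := j) (l := l)
  fun_prop

lemma decayConv_nonneg (hj : 0 ≤ j) (hH : ∀ s, 0 ≤ s → 0 ≤ H s) {t : ℝ} (ht : 0 ≤ t) :
    0 ≤ decayConv j l H t :=
  intervalIntegral.integral_nonneg ht fun s hs =>
    mul_nonneg (decayKernel_pos hj (by linarith [hs.2])).le (hH s hs.1)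

lemma decayConv_mono (hj : 0 ≤ j) (hH : Continuous H) {H' : ℝ → ℝ} (hH' : Continuous H')
    (h : ∀ s, 0 ≤ s → H s ≤ H' s) {t : ℝ} (ht : 0 ≤ t) :
    decayConv j l H t ≤ decayConv j l H' t := by
  refine intervalIntegral.integral_mono_on ht
    ((continuous_decayConv_integrand hH t).intervalIntegrable _ _)
    ((continuous_decayConv_integrand hH' t).intervalIntegrable _ _) fun s hs => ?_
  exact mul_le_mul_of_nonneg_left (h s hs.1) (decayKernel_pos hj (by linarith [hs.2])).le

lemma decayConv_const_mul (c t : ℝ) :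
    decayConv j l (fun s => c * H s) t = c * decayConv j l H t := by
  rw [decayConv, decayConv, ← intervalIntegral.integral_const_mul]
  congr 1; ext s; ring

/-- Under the integral over (0, s), K(t-s)K(s-σ) ≤ (1+s)K(t-σ); the remaining integral over (s, t)
is nonnegative. Hence the weight reproduces itself up to a loss 1 + s, which an exponentially small
factor can pay for. -/
lemma decayKernel_mul_decayConv_le (hj : 0 ≤ j) (hj1 : j ≤ 1) (hH : Continuous H)
    (hH0 : ∀ s, 0 ≤ s → 0 ≤ H s) {s t : ℝ} (hs : 0 ≤ s) (hst : s ≤ t) :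
    decayKernel j l (t - s) * decayConv j l H s ≤ (1 + s) * decayConv j l H t := by
  have h1 : decayConv j l H t = (∫ σ in (0 : ℝ)..s, decayKernel j l (t - σ) * H σ) +
      ∫ σ in s..t, decayKernel j l (t - σ) * H σ :=
    (intervalIntegral.integral_add_adjacent_intervals
      ((continuous_decayConv_integrand hH t).intervalIntegrable _ _)
      ((continuous_decayConv_integrand hH t).intervalIntegrable _ _)).symm
  have h2 : 0 ≤ ∫ σ in s..t, decayKernel j l (t - σ) * H σ :=
    intervalIntegral.integral_nonneg hst fun σ hσ =>
      mul_nonneg (decayKernel_pos hj (by linarith [hσ.2])).le (hH0 σ (hs.trans hσ.1))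
  have h3 : decayKernel j l (t - s) * decayConv j l H s ≤
      (1 + s) * ∫ σ in (0 : ℝ)..s, decayKernel j l (t - σ) * H σ := by
    rw [decayConv, ← intervalIntegral.integral_const_mul, ← intervalIntegral.integral_const_mul]
    refine intervalIntegral.integral_mono_on hs
      (((continuous_decayConv_integrand hH s).const_mul _).intervalIntegrable _ _)
      (((continuous_decayConv_integrand hH t).const_mul _).intervalIntegrable _ _) fun σ hσ => ?_
    rw [← mul_assoc, ← mul_assoc]
    refine mul_le_mul_of_nonneg_right ?_ (hH0 σ hσ.1)
    have := decayKernel_mul_le (l := l) hj hj1 (s := s - σ) (t := t - s) (by linarith [hσ.2])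
      (by linarith) (u := s) (by linarith [hσ.1])
    rwa [sub_add_sub_cancel] at this
  rw [h1, mul_add]
  have : 0 ≤ (1 + s) * ∫ σ in s..t, decayKernel j l (t - σ) * H σ := by positivity
  linarith

/-- The weight `c K + K * H`. -/
noncomputable def decayWeight (j l c : ℝ) (H : ℝ → ℝ) (t : ℝ) : ℝ :=
  c * decayKernel j l t + decayConv j l H t

variable {c : ℝ}

lemma continuous_decayWeight (hH : Continuous H) : Continuous (decayWeight j l c H) :=
  (continuous_decayKernel.const_mul c).add (continuous_decayConv hH)

lemma decayWeight_pos (hj : 0 ≤ j) (hc : 0 < c) (hH0 : ∀ s, 0 ≤ s → 0 ≤ H s) {t : ℝ}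
    (ht : 0 ≤ t) : 0 < decayWeight j l c H t :=
  add_pos_of_pos_of_nonneg (mul_pos hc (decayKernel_pos hj ht)) (decayConv_nonneg hj hH0 ht)

lemma decayKernel_mul_decayWeight_le (hj : 0 ≤ j) (hj1 : j ≤ 1) (hc : 0 ≤ c) (hH : Continuous H)
    (hH0 : ∀ s, 0 ≤ s → 0 ≤ H s) {s t : ℝ} (hs : 0 ≤ s) (hst : s ≤ t) :
    decayKernel j l (t - s) * decayWeight j l c H s ≤ (1 + s) * decayWeight j l c H t := by
  have h1 := decayKernel_mul_decayConv_le (l := l) hj hj1 hH hH0 hs hst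
  have h2 := decayKernel_mul_le (l := l) hj hj1 hs (sub_nonneg.2 hst) le_rfl
  rw [sub_add_cancel] at h2
  have h3 := mul_le_mul_of_nonneg_left h2 hc
  unfold decayWeight
  linarith

/-- Absorption: if `(1 + s) L(s) ≤ Λ e^{-ν s}` then `K * (L A) ≤ (Λ / ν) A` for the weight `A`. -/
lemma integral_decayKernel_mul_decayWeight_le (hj : 0 ≤ j) (hj1 : j ≤ 1) (hc : 0 ≤ c)
    (hH : Continuous H) (hH0 : ∀ s, 0 ≤ s → 0 ≤ H s) {L : ℝ → ℝ} (hL : Continuous L)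
    (hL0 : ∀ s, 0 ≤ s → 0 ≤ L s) {Λ ν : ℝ} (hν : 0 < ν) (hΛ : 0 ≤ Λ)
    (hLΛ : ∀ s, 0 ≤ s → (1 + s) * L s ≤ Λ * Real.exp (-(ν * s))) {t : ℝ} (ht : 0 ≤ t)
    (hA0 : 0 ≤ decayWeight j l c H t) :
    ∫ s in (0 : ℝ)..t, decayKernel j l (t - s) * (L s * decayWeight j l c H s) ≤
      Λ / ν * decayWeight j l c H t := by
  set A := decayWeight j l c H with hA
  have hAc : Continuous A := continuous_decayWeight hH
  have h1 : ∫ s in (0 : ℝ)..t, decayKernel j l (t - s) * (L s * A s) ≤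
      ∫ s in (0 : ℝ)..t, Λ * A t * Real.exp (-(ν * s)) := by
    refine intervalIntegral.integral_mono_on ht
      ((continuous_decayConv_integrand (hL.mul hAc) t).intervalIntegrable _ _)
      (Continuous.intervalIntegrable (by fun_prop) _ _) fun s hs => ?_
    have h2 := mul_le_mul_of_nonneg_left
      (decayKernel_mul_decayWeight_le (l := l) hj hj1 hc hH hH0 hs.1 hs.2) (hL0 s hs.1)
    have h3 := mul_le_mul_of_nonneg_right (hLΛ s hs.1) hA0
    rw [← hA] at h2
    linarith
  refine h1.trans ?_
  have h4 : ∫ s in (0 : ℝ)..t, Λ * A t * Real.exp (-(ν * s)) =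
      Λ * A t * ((1 - Real.exp (-(ν * t))) / ν) := by
    rw [intervalIntegral.integral_const_mul]
    congr 1
    have := intervalIntegral.integral_eq_sub_of_hasDerivAt
      (f := fun s => -(Real.exp (-(ν * s)) / ν)) (f' := fun s => Real.exp (-(ν * s))) (a := 0)
      (b := t) (fun s _ => ?_) (Continuous.intervalIntegrable (by fun_prop) _ _)
    · rw [this]; simp; ring
    · refine (((hasDerivAt_exp_neg_mul ν s).div_const ν).neg).congr_deriv ?_
      field_simp
  rw [h4]
  have h5 : (1 - Real.exp (-(ν * t))) / ν ≤ 1 / ν :=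
    div_le_div_of_nonneg_right (by linarith [Real.exp_pos (-(ν * t))]) hν.le
  calc Λ * A t * ((1 - Real.exp (-(ν * t))) / ν) ≤ Λ * A t * (1 / ν) :=
        mul_le_mul_of_nonneg_left h5 (mul_nonneg hΛ hA0)
    _ = Λ / ν * A t := by ring

lemma one_add_le_exp_mul {ε : ℝ} (hε : 0 < ε) {t : ℝ} (ht : 0 ≤ t) :
    1 + t ≤ (1 + 1 / ε) * Real.exp (ε * t) := by
  have h1 := Real.add_one_le_exp (ε * t)
  have h2 : (1 + 1 / ε) * (ε * t + 1) ≤ (1 + 1 / ε) * Real.exp (ε * t) :=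
    mul_le_mul_of_nonneg_left h1 (by positivity)
  refine le_trans ?_ h2
  have e : (1 + 1 / ε) * (ε * t + 1) = ε * t + 1 + t + 1 / ε := by field_simp; ring
  rw [e]
  have : 0 ≤ ε * t + 1 / ε := by positivity
  linarith

lemma decayKernel_le_exp (hj1 : j ≤ 1) {ν : ℝ} (hν : ν < l) {t : ℝ} (ht : 0 ≤ t) :
    decayKernel j l t ≤ (1 + 1 / (l - ν)) * Real.exp (-(ν * t)) := by
  have h1 := one_add_le_exp_mul (sub_pos.2 hν) ht
  have h2 : Real.exp (-(ν * t)) = Real.exp ((l - ν) * t) * Real.exp (-(l * t)) := by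
    rw [← Real.exp_add]; congr 1; ring
  rw [h2, decayKernel, ← mul_assoc]
  refine mul_le_mul_of_nonneg_right (le_trans ?_ h1) (Real.exp_pos _).le
  nlinarith

/-- A forcing term that decays slower than the kernel. -/
lemma decayConv_exp_le_of_lt (hj1 : j ≤ 1) {μ : ℝ} (hμ : μ < l) {t : ℝ}
    (ht : 0 ≤ t) :
    decayConv j l (fun s => Real.exp (-(μ * s))) t ≤
      (1 + 2 / (l - μ)) * (2 / (l - μ)) * Real.exp (-(μ * t)) := by
  -- Half of the gap l - μ pays for the linear factor of the kernel, and the other half for the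
  -- convergence of the integral.
  set δ := (l - μ) / 2 with hδ
  have hδ0 : 0 < δ := by rw [hδ]; linarith
  have e2 : 2 / (l - μ) = 1 / δ := by rw [hδ]; field_simp
  have hlδ : l - (μ + δ) = δ := by rw [hδ]; ring
  have h1 : decayConv j l (fun s => Real.exp (-(μ * s))) t ≤
      ∫ s in (0 : ℝ)..t, (1 + 1 / δ) * Real.exp (-(μ * t)) * Real.exp (-(δ * (t - s))) := by
    refine intervalIntegral.integral_mono_on ht
      ((continuous_decayConv_integrand (by fun_prop) t).intervalIntegrable _ _)
      (Continuous.intervalIntegrable (by fun_prop) _ _) fun s hs => ?_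
    have h2 := decayKernel_le_exp hj1 (ν := μ + δ) (l := l) (by linarith) (t := t - s)
      (by linarith [hs.2])
    rw [hlδ] at h2
    have h3 := mul_le_mul_of_nonneg_right h2 (Real.exp_pos (-(μ * s))).le
    refine h3.trans_eq ?_
    rw [mul_assoc, mul_assoc, ← Real.exp_add, ← Real.exp_add]
    congr 2; ring
  refine h1.trans ?_
  have h4 : ∫ s in (0 : ℝ)..t, Real.exp (-(δ * (t - s))) = (1 - Real.exp (-(δ * t))) / δ := by
    have := intervalIntegral.integral_eq_sub_of_hasDerivAt
      (f := fun s => Real.exp (-(δ * (t - s))) / δ) (f' := fun s => Real.exp (-(δ * (t - s))))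
      (a := 0) (b := t) (fun s _ => ?_) (Continuous.intervalIntegrable (by fun_prop) _ _)
    · rw [this]; simp; ring
    · have h5 := (hasDerivAt_exp_neg_mul δ (t - s)).comp s ((hasDerivAt_id s).const_sub t)
      refine (h5.div_const δ).congr_deriv ?_
      field_simp
  rw [intervalIntegral.integral_const_mul, h4, e2]
  have h5 : (1 - Real.exp (-(δ * t))) / δ ≤ 1 / δ :=
    div_le_div_of_nonneg_right (by linarith [Real.exp_pos (-(δ * t))]) hδ0.le
  have := mul_le_mul_of_nonneg_left h5
    (show 0 ≤ (1 + 1 / δ) * Real.exp (-(μ * t)) by positivity)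
  linarith

/-- A forcing term that decays faster than the kernel. -/
lemma decayConv_exp_le_of_gt (hj : 0 ≤ j) {μ : ℝ} (hμ : l < μ) {t : ℝ} (ht : 0 ≤ t) :
    decayConv j l (fun s => Real.exp (-(μ * s))) t ≤ 1 / (μ - l) * decayKernel j l t := by
  set δ := μ - l with hδ
  have hδ0 : 0 < δ := by rw [hδ]; linarith
  have h1 : decayConv j l (fun s => Real.exp (-(μ * s))) t ≤
      ∫ s in (0 : ℝ)..t, decayKernel j l t * Real.exp (-(δ * s)) := by
    refine intervalIntegral.integral_mono_on ht
      ((continuous_decayConv_integrand (by fun_prop) t).intervalIntegrable _ _)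
      (Continuous.intervalIntegrable (by fun_prop) _ _) fun s hs => ?_
    rw [decayKernel, decayKernel, mul_assoc, mul_assoc, ← Real.exp_add, ← Real.exp_add,
      show -(l * (t - s)) + -(μ * s) = -(l * t) + -(δ * s) by rw [hδ]; ring]
    refine mul_le_mul_of_nonneg_right ?_ (Real.exp_pos _).le
    nlinarith [hs.1, mul_nonneg hj hs.1]
  refine h1.trans ?_
  have h4 : ∫ s in (0 : ℝ)..t, Real.exp (-(δ * s)) = (1 - Real.exp (-(δ * t))) / δ := by
    have := intervalIntegral.integral_eq_sub_of_hasDerivAt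
      (f := fun s => -(Real.exp (-(δ * s)) / δ)) (f' := fun s => Real.exp (-(δ * s)))
      (a := 0) (b := t) (fun s _ => ?_) (Continuous.intervalIntegrable (by fun_prop) _ _)
    · rw [this]; simp; ring
    · refine (((hasDerivAt_exp_neg_mul δ s).div_const δ).neg).congr_deriv ?_
      field_simp
  rw [intervalIntegral.integral_const_mul, h4]
  have h5 : (1 - Real.exp (-(δ * t))) / δ ≤ 1 / δ :=
    div_le_div_of_nonneg_right (by linarith [Real.exp_pos (-(δ * t))]) hδ0.le
  have := mul_le_mul_of_nonneg_left h5 (decayKernel_pos (l := l) hj ht).le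
  linarith

/-- Resonant forcing. -/
lemma decayConv_exp_le_of_eq (hj : 0 ≤ j) {t : ℝ} (ht : 0 ≤ t) :
    decayConv j l (fun s => Real.exp (-(l * s))) t ≤ t * decayKernel j l t := by
  have h1 : decayConv j l (fun s => Real.exp (-(l * s))) t ≤
      ∫ _s in (0 : ℝ)..t, decayKernel j l t := by
    refine intervalIntegral.integral_mono_on ht
      ((continuous_decayConv_integrand (by fun_prop) t).intervalIntegrable _ _)
      (Continuous.intervalIntegrable (by fun_prop) _ _) fun s hs => ?_
    rw [decayKernel, decayKernel, mul_assoc, ← Real.exp_add,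
      show -(l * (t - s)) + -(l * s) = -(l * t) by ring]
    refine mul_le_mul_of_nonneg_right ?_ (Real.exp_pos _).le
    nlinarith [hs.1, mul_nonneg hj hs.1]
  simpa using h1

/-- A forcing term that does not vanish identically dominates the kernel. -/
lemma exists_decayKernel_le_decayConv (hj : 0 ≤ j) (hl : 0 ≤ l) (hH : Continuous H)
    (hH0 : ∀ s, 0 ≤ s → 0 ≤ H s) {s₀ : ℝ} (hs₀ : 0 < s₀) (h : 0 < H s₀) :
    ∃ C, 0 < C ∧ ∀ᶠ t in atTop, decayKernel j l t ≤ C * decayConv j l H t := by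
  obtain ⟨m, hm, hm'⟩ : ∃ m, 0 < m ∧ ∀ᶠ s in 𝓝 s₀, m < H s :=
    ⟨H s₀ / 2, by linarith, hH.continuousAt.eventually (lt_mem_nhds (by linarith))⟩
  obtain ⟨ε, hε, hε'⟩ := Metric.eventually_nhds_iff.1 hm'
  set s₁ := s₀ + ε / 2 with hs₁
  have hs₁0 : 0 < s₁ := by positivity
  have hmH : ∀ s ∈ Icc s₀ s₁, m ≤ H s := fun s hs => (hε' (by
    rw [Real.dist_eq, abs_lt]; constructor <;> linarith [hs.1, hs.2])).le
  refine ⟨(1 + j * s₁) / (m * (ε / 2)), by positivity, ?_⟩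
  filter_upwards [eventually_ge_atTop s₁] with t ht
  have hi := fun u v => (continuous_decayConv_integrand (j := j) (l := l) hH t).intervalIntegrable
    (μ := MeasureTheory.volume) u v
  have hnn : ∀ s, 0 ≤ s → s ≤ t → 0 ≤ decayKernel j l (t - s) * H s := fun s hs hst =>
    mul_nonneg (decayKernel_pos hj (by linarith)).le (hH0 s hs)
  have h1 : ∫ s in s₀..s₁, decayKernel j l (t - s) * H s ≤ decayConv j l H t := by
    rw [decayConv, ← intervalIntegral.integral_add_adjacent_intervals (hi 0 s₀) (hi s₀ t),
      ← intervalIntegral.integral_add_adjacent_intervals (hi s₀ s₁) (hi s₁ t)]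
    have n1 : 0 ≤ ∫ s in (0 : ℝ)..s₀, decayKernel j l (t - s) * H s :=
      intervalIntegral.integral_nonneg hs₀.le fun s hs => hnn s hs.1 (by linarith [hs.2])
    have n2 : 0 ≤ ∫ s in s₁..t, decayKernel j l (t - s) * H s :=
      intervalIntegral.integral_nonneg ht fun s hs => hnn s (by linarith [hs.1]) hs.2
    linarith
  -- Near s₀ the forcing is at least m, and a shift of the kernel by s ≤ s₁ costs at most the factor
  -- 1 + j s₁, uniformly in t.
  have h2 : ∫ _s in s₀..s₁, decayKernel j l t / (1 + j * s₁) * m ≤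
      ∫ s in s₀..s₁, decayKernel j l (t - s) * H s := by
    refine intervalIntegral.integral_mono_on (by linarith)
      (Continuous.intervalIntegrable (by fun_prop) _ _) (hi _ _) fun s hs => ?_
    have hs0 : 0 ≤ s := by linarith [hs.1]
    refine mul_le_mul ?_ (hmH s hs) hm.le (decayKernel_pos hj (by linarith [hs.2])).le
    rw [div_le_iff₀ (by positivity), decayKernel, decayKernel]
    have e1 : Real.exp (-(l * t)) ≤ Real.exp (-(l * (t - s))) :=
      Real.exp_le_exp.2 (by nlinarith [mul_nonneg hl hs0])
    have e2 : 1 + j * t ≤ (1 + j * (t - s)) * (1 + j * s₁) := by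
      have a1 : 0 ≤ j * (s₁ - s) := mul_nonneg hj (by linarith [hs.2])
      have a2 : 0 ≤ j * (t - s) * (j * s₁) :=
        mul_nonneg (mul_nonneg hj (by linarith [hs.2])) (by positivity)
      nlinarith
    rw [mul_right_comm]
    exact mul_le_mul e2 e1 (Real.exp_pos _).le (mul_nonneg
      (add_nonneg zero_le_one (mul_nonneg hj (by linarith [hs.2]))) (by positivity))
  rw [intervalIntegral.integral_const, smul_eq_mul] at h2
  have h3 := h2.trans h1
  have e : s₁ - s₀ = ε / 2 := by rw [hs₁]; ring
  rw [e] at h3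
  rw [div_mul_eq_mul_div, le_div_iff₀ (by positivity)]
  have h4 := mul_le_mul_of_nonneg_left h3 (show 0 ≤ 1 + j * s₁ by positivity)
  refine le_trans (le_of_eq ?_) h4
  have : 1 + j * s₁ ≠ 0 := by positivity
  field_simp

/-! The nonlinearity `s ^ p + s ^ r` and its tail integral. -/

section Nonlin

variable {p r s : ℝ}

lemma nonlin_pos (hs : 0 < s) : 0 < nonlin p r s := by
  unfold nonlin
  positivity

lemma hasDerivAt_nonlin (hs : 0 < s) :
    HasDerivAt (nonlin p r) (p * s ^ (p - 1) + r * s ^ (r - 1)) s :=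
  (Real.hasDerivAt_rpow_const (Or.inl hs.ne')).add (Real.hasDerivAt_rpow_const (Or.inl hs.ne'))

lemma deriv_nonlin (hs : 0 < s) : deriv (nonlin p r) s = p * s ^ (p - 1) + r * s ^ (r - 1) :=
  (hasDerivAt_nonlin hs).deriv

lemma hasDerivAt_deriv_nonlin (hs : 0 < s) :
    HasDerivAt (deriv (nonlin p r))
      (p * ((p - 1) * s ^ (p - 2)) + r * ((r - 1) * s ^ (r - 2))) s := by
  have h1 : deriv (nonlin p r) =ᶠ[𝓝 s] fun s => p * s ^ (p - 1) + r * s ^ (r - 1) := by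
    filter_upwards [lt_mem_nhds hs] with t ht using deriv_nonlin ht
  refine HasDerivAt.congr_of_eventuallyEq ?_ h1
  refine (((Real.hasDerivAt_rpow_const (p := p - 1) (Or.inl hs.ne')).const_mul p).add
    ((Real.hasDerivAt_rpow_const (p := r - 1) (Or.inl hs.ne')).const_mul r)).congr_deriv ?_
  rw [show p - 1 - 1 = p - 2 by ring, show r - 1 - 1 = r - 2 by ring]

lemma contDiffOn_nonlin : ContDiffOn ℝ 2 (nonlin p r) (Ioi 0) := by
  intro x hx
  have hx' : x ≠ 0 := (mem_Ioi.1 hx).ne'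
  exact ((Real.contDiffAt_rpow_const_of_ne hx').add
    (Real.contDiffAt_rpow_const_of_ne hx')).contDiffWithinAt

lemma rpow_eq_mul_rpow_sub (hs : 0 < s) (c d : ℝ) : s ^ c = s ^ d * s ^ (c - d) := by
  rw [← Real.rpow_add hs]; congr 1; ring

lemma nonlin_eq_mul (hs : 0 < s) : nonlin p r s = s ^ p * (1 + s ^ (r - p)) := by
  rw [nonlin, rpow_eq_mul_rpow_sub hs r p]; ring

lemma deriv_nonlin_eq_mul (hs : 0 < s) :
    deriv (nonlin p r) s = s ^ (p - 1) * (p + r * s ^ (r - p)) := by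
  rw [deriv_nonlin hs, rpow_eq_mul_rpow_sub hs (r - 1) (p - 1),
    show r - 1 - (p - 1) = r - p by ring]
  ring

lemma deriv_deriv_nonlin_eq_mul (hs : 0 < s) :
    deriv (deriv (nonlin p r)) s =
      s ^ (p - 2) * (p * (p - 1) + r * (r - 1) * s ^ (r - p)) := by
  rw [(hasDerivAt_deriv_nonlin hs).deriv, rpow_eq_mul_rpow_sub hs (r - 2) (p - 2),
    show r - 2 - (p - 2) = r - p by ring]
  ring

/-- The leading powers of f'² and f f'' cancel, which leaves a rational function of s^(r-p). -/
lemma rpow_sub_one_sq (hs : 0 < s) : (s ^ (p - 1)) ^ 2 = s ^ p * s ^ (p - 2) := by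
  rw [← Real.rpow_natCast, ← Real.rpow_mul hs.le, ← Real.rpow_add hs]
  congr 1
  push_cast
  ring

lemma tendsto_rpow_sub_atTop (hrp : r < p) : Tendsto (fun s : ℝ => s ^ (r - p)) atTop (𝓝 0) := by
  have := tendsto_rpow_neg_atTop (sub_pos.2 hrp)
  simpa using this

lemma tendsto_deriv_sq_div (hp : 1 < p) (hrp : r < p) :
    Tendsto (fun s : ℝ => deriv (nonlin p r) s ^ 2 /
      (nonlin p r s * deriv (deriv (nonlin p r)) s)) atTop (𝓝 (p / (p - 1))) := by
  have h0 := tendsto_rpow_sub_atTop hrp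
  have h1 : Tendsto (fun s : ℝ => (p + r * s ^ (r - p)) ^ 2 /
      ((1 + s ^ (r - p)) * (p * (p - 1) + r * (r - 1) * s ^ (r - p)))) atTop
      (𝓝 ((p + r * 0) ^ 2 / ((1 + 0) * (p * (p - 1) + r * (r - 1) * 0)))) := by
    refine Tendsto.div ((tendsto_const_nhds.add (h0.const_mul r)).pow 2)
      ((tendsto_const_nhds.add h0).mul (tendsto_const_nhds.add (h0.const_mul _))) ?_
    have : p * (p - 1) ≠ 0 := mul_ne_zero (by linarith) (by linarith)
    simpa using this
  have e : (p + r * 0) ^ 2 / ((1 + 0) * (p * (p - 1) + r * (r - 1) * 0)) = p / (p - 1) := by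
    have h2 : p ≠ 0 := by linarith
    have h3 : p - 1 ≠ 0 := by linarith
    field_simp
    ring
  rw [e] at h1
  refine h1.congr' ?_
  filter_upwards [eventually_gt_atTop 0] with s hs
  rw [deriv_nonlin_eq_mul hs, nonlin_eq_mul hs, deriv_deriv_nonlin_eq_mul hs, mul_pow,
    rpow_sub_one_sq hs, mul_mul_mul_comm, mul_div_mul_left]
  positivity

/-! ### The tail integral F and its inverse. -/

lemma integrableOn_inv_nonlin (hp : 1 < p) (hs : 0 < s) :
    MeasureTheory.IntegrableOn (fun η => 1 / nonlin p r η) (Ioi s) := by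
  have h1 := integrableOn_Ioi_rpow_of_lt (show -p < -1 by linarith) hs
  refine MeasureTheory.Integrable.mono' h1 ?_ ?_
  · refine ContinuousOn.aestronglyMeasurable (fun x hx => ?_) measurableSet_Ioi
    have hx0 : 0 < x := hs.trans hx
    exact (continuousAt_const.div ((hasDerivAt_nonlin hx0).continuousAt)
      (nonlin_pos hx0).ne').continuousWithinAt
  · refine (MeasureTheory.ae_restrict_iff' measurableSet_Ioi).2 (Eventually.of_forall fun x hx => ?_)
    have hx0 : 0 < x := hs.trans hx
    rw [Real.norm_eq_abs, abs_of_pos (one_div_pos.2 (nonlin_pos hx0)), Real.rpow_neg hx0.le,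
      ← one_div]
    refine one_div_le_one_div_of_le (by positivity) ?_
    unfold nonlin
    have : 0 < x ^ r := by positivity
    linarith

lemma tailInt_sub (hp : 1 < p) {t : ℝ} (hs : 0 < s) (hst : s ≤ t) :
    tailInt (nonlin p r) s = (∫ η in s..t, 1 / nonlin p r η) + tailInt (nonlin p r) t :=
  (intervalIntegral.integral_interval_add_Ioi (integrableOn_inv_nonlin hp hs)
    (integrableOn_inv_nonlin hp (hs.trans_le hst))).symm

lemma hasDerivAt_tailInt (hp : 1 < p) (hs : 0 < s) :
    HasDerivAt (tailInt (nonlin p r)) (-(1 / nonlin p r s)) s := by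
  have hc : ∀ x, 0 < x → ContinuousAt (fun η => 1 / nonlin p r η) x := fun x hx =>
    continuousAt_const.div ((hasDerivAt_nonlin hx).continuousAt) (nonlin_pos hx).ne'
  have hint : ∀ u v, 0 < u → 0 < v → IntervalIntegrable (fun η => 1 / nonlin p r η)
      MeasureTheory.volume u v := fun u v hu hv =>
    ContinuousOn.intervalIntegrable fun x hx =>
      (hc x (lt_of_lt_of_le (lt_min hu hv) hx.1)).continuousWithinAt
  have h1 : HasDerivAt (fun t => (∫ η in t..s + 1, 1 / nonlin p r η) + tailInt (nonlin p r) (s + 1))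
      (-(1 / nonlin p r s)) s := by
    refine HasDerivAt.add_const _ (intervalIntegral.integral_hasDerivAt_left
      (hint s (s + 1) hs (by linarith)) ?_ (hc s hs))
    exact ContinuousAt.stronglyMeasurableAtFilter isOpen_Ioi (fun x hx => hc x hx) s hs
  refine h1.congr_of_eventuallyEq ?_
  filter_upwards [Ioo_mem_nhds hs (lt_add_one s)] with t ht
  exact tailInt_sub hp ht.1 ht.2.le

lemma hasStrictDerivAt_tailInt (hp : 1 < p) (hs : 0 < s) :
    HasStrictDerivAt (tailInt (nonlin p r)) (-(1 / nonlin p r s)) s := by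
  refine hasStrictDerivAt_of_hasDerivAt_of_continuousAt (f' := fun s => -(1 / nonlin p r s)) ?_
    (continuousAt_const.div ((hasDerivAt_nonlin hs).continuousAt) (nonlin_pos hs).ne').neg
  filter_upwards [lt_mem_nhds hs] with t ht using hasDerivAt_tailInt hp ht

lemma strictAntiOn_tailInt (hp : 1 < p) : StrictAntiOn (tailInt (nonlin p r)) (Ioi 0) := by
  refine strictAntiOn_of_deriv_neg (convex_Ioi 0)
    (fun x hx => (hasDerivAt_tailInt hp hx).continuousAt.continuousWithinAt) fun x hx => ?_
  rw [interior_Ioi] at hx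
  rw [(hasDerivAt_tailInt hp hx).deriv]
  exact neg_neg_of_pos (one_div_pos.2 (nonlin_pos hx))

lemma tailInt_le (hp : 1 < p) (hs : 0 < s) :
    tailInt (nonlin p r) s ≤ s ^ (1 - p) / (p - 1) := by
  have h1 : ∫ η in Ioi s, η ^ (-p) = s ^ (1 - p) / (p - 1) := by
    rw [integral_Ioi_rpow_of_lt (by linarith) hs, show -p + 1 = 1 - p by ring,
      show 1 - p = -(p - 1) by ring, div_neg, neg_div, neg_neg]
  rw [← h1, tailInt]
  refine MeasureTheory.setIntegral_mono_on (integrableOn_inv_nonlin hp hs)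
    (integrableOn_Ioi_rpow_of_lt (by linarith) hs) measurableSet_Ioi fun x hx => ?_
  have hx0 : 0 < x := hs.trans hx
  rw [Real.rpow_neg hx0.le, ← one_div]
  refine one_div_le_one_div_of_le (by positivity) ?_
  unfold nonlin
  have : 0 < x ^ r := by positivity
  linarith

/-- For η > s one has f(η) = η^p (1 + η^(r-p)) ≤ η^p (1 + s^(r-p)), because r < p. -/
lemma le_tailInt (hp : 1 < p) (hrp : r < p) (hs : 0 < s) :
    s ^ (1 - p) / (p - 1) / (1 + s ^ (r - p)) ≤ tailInt (nonlin p r) s := by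
  have h1 : ∫ η in Ioi s, η ^ (-p) / (1 + s ^ (r - p)) =
      s ^ (1 - p) / (p - 1) / (1 + s ^ (r - p)) := by
    rw [MeasureTheory.integral_div,
      integral_Ioi_rpow_of_lt (by linarith) hs, show -p + 1 = 1 - p by ring,
      show 1 - p = -(p - 1) by ring]
    congr 1
    rw [div_neg, neg_div, neg_neg]
  rw [← h1, tailInt]
  refine MeasureTheory.setIntegral_mono_on
    ((integrableOn_Ioi_rpow_of_lt (by linarith) hs).div_const _) (integrableOn_inv_nonlin hp hs)
    measurableSet_Ioi fun x hx => ?_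
  have hx0 : 0 < x := hs.trans hx
  have h2 : x ^ (r - p) ≤ s ^ (r - p) :=
    Real.rpow_le_rpow_of_nonpos hs (mem_Ioi.1 hx).le (by linarith)
  rw [Real.rpow_neg hx0.le, ← one_div, div_div]
  refine one_div_le_one_div_of_le (nonlin_pos hx0) ?_
  rw [nonlin_eq_mul hx0]
  exact mul_le_mul_of_nonneg_left (by linarith) (by positivity)

lemma tailInt_pos (hp : 1 < p) (hrp : r < p) (hs : 0 < s) : 0 < tailInt (nonlin p r) s :=
  lt_of_lt_of_le (div_pos (div_pos (by positivity) (by linarith)) (by positivity))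
    (le_tailInt hp hrp hs)

lemma tendsto_tailInt (hp : 1 < p) (hrp : r < p) :
    Tendsto (tailInt (nonlin p r)) atTop (𝓝 0) := by
  have h1 : Tendsto (fun s : ℝ => s ^ (1 - p) / (p - 1)) atTop (𝓝 (0 / (p - 1))) :=
    (tendsto_rpow_sub_atTop hp).div_const _
  rw [zero_div] at h1
  refine tendsto_of_tendsto_of_tendsto_of_le_of_le' tendsto_const_nhds h1 ?_ ?_
  · filter_upwards [eventually_gt_atTop 0] with s hs using (tailInt_pos hp hrp hs).le
  · filter_upwards [eventually_gt_atTop 0] with s hs using tailInt_le hp hs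

lemma mem_image_tailInt (hp : 1 < p) (hrp : r < p) {y : ℝ} (hy : 0 < y)
    (hy1 : y ≤ tailInt (nonlin p r) 1) : y ∈ tailInt (nonlin p r) '' Ioi 0 := by
  obtain ⟨S, hS, hS1⟩ := (((tendsto_tailInt hp hrp).eventually (gt_mem_nhds hy)).and
    (eventually_ge_atTop 1)).exists
  have hc : ContinuousOn (tailInt (nonlin p r)) (Icc 1 S) := fun x hx =>
    (hasDerivAt_tailInt hp (zero_lt_one.trans_le hx.1)).continuousAt.continuousWithinAt
  obtain ⟨x, hx, hxy⟩ := intermediate_value_Icc' hS1 hc ⟨hS.le, hy1⟩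
  exact ⟨x, zero_lt_one.trans_le hx.1, hxy⟩

lemma tailInv_tailInt (hp : 1 < p) (hs : 0 < s) :
    tailInv (nonlin p r) (tailInt (nonlin p r) s) = s :=
  (strictAntiOn_tailInt hp).injOn.leftInvOn_invFunOn hs

/-- Arguments up to F(1) keep the inverse at values s ≥ 1, where the deviation s^(r-p) is at most 1.
-/
lemma tailInv_spec (hp : 1 < p) (hrp : r < p) {y : ℝ} (hy : 0 < y)
    (hy1 : y ≤ tailInt (nonlin p r) 1) :
    1 ≤ tailInv (nonlin p r) y ∧ tailInt (nonlin p r) (tailInv (nonlin p r) y) = y := by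
  have h0 : (0 : ℝ) < tailInv (nonlin p r) y := Function.invFunOn_mem (mem_image_tailInt hp hrp hy hy1)
  have h1 : tailInt (nonlin p r) (tailInv (nonlin p r) y) = y :=
    Function.invFunOn_eq (mem_image_tailInt hp hrp hy hy1)
  refine ⟨?_, h1⟩
  by_contra! hlt
  have := strictAntiOn_tailInt (r := r) hp (mem_Ioi.2 h0) (mem_Ioi.2 zero_lt_one) hlt
  linarith

/-- By strict monotonicity the chosen inverse is a left inverse on all of (0, ∞), hence the local
inverse; its derivative is -f since F' = -1/f. -/
lemma hasDerivAt_tailInv (hp : 1 < p) (hrp : r < p) {y : ℝ} (hy : 0 < y)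
    (hy1 : y ≤ tailInt (nonlin p r) 1) :
    HasDerivAt (tailInv (nonlin p r)) (-nonlin p r (tailInv (nonlin p r) y)) y := by
  obtain ⟨h1, h2⟩ := tailInv_spec hp hrp hy hy1
  have h0 : 0 < tailInv (nonlin p r) y := zero_lt_one.trans_le h1
  have hn := nonlin_pos (p := p) (r := r) h0
  have h3 := (hasStrictDerivAt_tailInt (r := r) hp h0).to_local_left_inverse
    (neg_ne_zero.2 (one_div_pos.2 hn).ne') (g := tailInv (nonlin p r)) (by
      filter_upwards [lt_mem_nhds h0] with x hx using tailInv_tailInt hp hx)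
  rw [h2] at h3
  refine h3.hasDerivAt.congr_deriv ?_
  rw [one_div, inv_neg, inv_inv]

lemma tendsto_tailInv (hp : 1 < p) (hrp : r < p) :
    Tendsto (tailInv (nonlin p r)) (𝓝[>] 0) atTop := by
  refine tendsto_atTop.2 fun B => ?_
  have hB : 0 < max B 1 := lt_max_of_lt_right one_pos
  have h1 := tailInt_pos hp hrp hB
  have h2 := tailInt_pos hp hrp one_pos
  filter_upwards [self_mem_nhdsWithin, mem_nhdsWithin_of_mem_nhds (gt_mem_nhds h1),
    mem_nhdsWithin_of_mem_nhds (gt_mem_nhds h2)] with y hy hyB hy1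
  obtain ⟨h3, h4⟩ := tailInv_spec hp hrp hy (le_of_lt hy1)
  by_contra! hlt
  have := strictAntiOn_tailInt (r := r) hp (mem_Ioi.2 (zero_lt_one.trans_le h3)) hB
    (hlt.trans_le (le_max_left _ _))
  rw [h4] at this
  exact absurd hyB (not_lt.2 this.le)

/-! Deviations from the pure power case, in terms of `e = s ^ (r - p)`. -/

/-- `F(s) f(s) / s`. -/
noncomputable def tailRatio (p r s : ℝ) : ℝ := tailInt (nonlin p r) s * nonlin p r s / s

/-- `f'(s) F(s) - q` with `q = p / (p - 1)`. -/
noncomputable def holderDefect (p r s : ℝ) : ℝ :=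
  deriv (nonlin p r) s * tailInt (nonlin p r) s - p / (p - 1)

/-- The share of `s ^ r` in `f(s)`. -/
noncomputable def lowerShare (p r s : ℝ) : ℝ := s ^ r / nonlin p r s

/-- The quantity (p-1)F(s)s^(p-1) equals 1 for a pure power; here it is pinched between
1/(1+s^(r-p)) and 1. The bounds on `tailRatio` and `holderDefect` follow from this. -/
lemma normalized_tailInt_mem (hp : 1 < p) (hrp : r < p) (hs : 0 < s) :
    1 ≤ (p - 1) * (tailInt (nonlin p r) s * s ^ (p - 1)) * (1 + s ^ (r - p)) ∧
      (p - 1) * (tailInt (nonlin p r) s * s ^ (p - 1)) ≤ 1 := by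
  have h1 := tailInt_le (r := r) hp hs
  have h2 := le_tailInt hp hrp hs
  have hp1 : 0 < p - 1 := by linarith
  have e1 : s ^ (1 - p) * s ^ (p - 1) = 1 := by
    rw [← Real.rpow_add hs]; simp
  have h3 : 0 < s ^ (p - 1) := by positivity
  have h4 : 0 < 1 + s ^ (r - p) := by positivity
  rw [div_le_iff₀ h4, div_le_iff₀ hp1] at h2
  rw [le_div_iff₀ hp1] at h1
  constructor
  · have := mul_le_mul_of_nonneg_right h2 h3.le
    rw [e1] at this
    linarith
  · have := mul_le_mul_of_nonneg_right h1 h3.le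
    rw [e1] at this
    linarith

lemma tailRatio_bounds (hp : 1 < p) (hrp : r < p) (hs : 0 < s) :
    0 ≤ (p - 1) * tailRatio p r s - 1 ∧ (p - 1) * tailRatio p r s - 1 ≤ s ^ (r - p) := by
  obtain ⟨h1, h2⟩ := normalized_tailInt_mem hp hrp hs
  have e : (p - 1) * tailRatio p r s =
      (p - 1) * (tailInt (nonlin p r) s * s ^ (p - 1)) * (1 + s ^ (r - p)) := by
    rw [tailRatio, nonlin_eq_mul hs, Real.rpow_sub_one hs.ne']
    field_simp
  rw [e]
  refine ⟨by linarith, ?_⟩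
  have := mul_le_mul_of_nonneg_right h2 (show 0 ≤ 1 + s ^ (r - p) by positivity)
  linarith

lemma abs_holderDefect_le (hp : 1 < p) (hr : 0 < r) (hrp : r < p) (hs : 0 < s) :
    |holderDefect p r s| ≤ p / (p - 1) * s ^ (r - p) := by
  obtain ⟨h1, h2⟩ := normalized_tailInt_mem hp hrp hs
  have hp1 : 0 < p - 1 := by linarith
  set e := s ^ (r - p) with he
  have he0 : 0 < e := by positivity
  set Φ := (p - 1) * (tailInt (nonlin p r) s * s ^ (p - 1)) with hΦ
  have e1 : holderDefect p r s = ((p + r * e) * Φ - p) / (p - 1) := by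
    rw [holderDefect, deriv_nonlin_eq_mul hs, hΦ, ← he]
    field_simp
  rw [e1, abs_div, abs_of_pos hp1, div_mul_eq_mul_div]
  refine div_le_div_of_nonneg_right (abs_le.2 ⟨?_, ?_⟩) hp1.le
  · have hΦ0 : 0 < Φ := by
      by_contra! hneg
      nlinarith
    nlinarith [mul_pos he0 hΦ0, mul_nonneg (mul_pos hr he0).le hΦ0.le, mul_le_mul_of_nonneg_left h2 he0.le]
  · nlinarith [mul_pos hr he0, mul_lt_mul_of_pos_right hrp he0]

lemma lowerShare_bounds (hs : 0 < s) :
    0 ≤ lowerShare p r s ∧ lowerShare p r s ≤ 1 ∧ lowerShare p r s ≤ s ^ (r - p) := by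
  have h1 : 0 < s ^ r := by positivity
  have h2 : 0 < s ^ p := by positivity
  have h3 := nonlin_pos (p := p) (r := r) hs
  refine ⟨by unfold lowerShare; positivity, ?_, ?_⟩
  · rw [lowerShare, div_le_one h3, nonlin]
    linarith
  · rw [lowerShare, div_le_iff₀ h3, nonlin, mul_add, ← Real.rpow_add hs]
    have : 0 < s ^ (r - p) * s ^ r := by positivity
    simp only [sub_add_cancel]
    linarith

/-- The defect does not vanish on a half-line. -/
lemma exists_holderDefect_ne_zero (hp : 1 < p) (hr : 0 < r) (hrp : r < p) (S : ℝ) :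
    ∃ s, S < s ∧ holderDefect p r s ≠ 0 := by
  by_contra! hz
  -- If f'F = q persists, differentiation gives f''F = f'/f. Eliminating F leaves q f f'' = f'², an
  -- algebraic identity in e = s^(r-p) that factors; its only possible root fixes e, yet e is
  -- strictly decreasing in s.
  have key : ∀ s, max S 0 < s → p * (p - r - 1) = r * s ^ (r - p) := by
    intro s hs
    have hs0 : 0 < s := (le_max_right _ _).trans_lt hs
    have h1 : holderDefect p r =ᶠ[𝓝 s] fun _ => 0 := by
      filter_upwards [lt_mem_nhds hs] with t ht using hz t ((le_max_left _ _).trans_lt ht)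
    have h2 : HasDerivAt (holderDefect p r) 0 s :=
      (hasDerivAt_const s (0 : ℝ)).congr_of_eventuallyEq h1
    have h3 := ((hasDerivAt_deriv_nonlin (p := p) (r := r) hs0).mul
      (hasDerivAt_tailInt (r := r) hp hs0)).sub_const (p / (p - 1))
    have h4 := h2.unique h3
    have h5 : holderDefect p r s = 0 := hz s ((le_max_left _ _).trans_lt hs)
    rw [holderDefect] at h5
    rw [← (hasDerivAt_deriv_nonlin hs0).deriv, deriv_deriv_nonlin_eq_mul hs0] at h4
    rw [deriv_nonlin_eq_mul hs0] at h4 h5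
    rw [nonlin_eq_mul hs0] at h4
    have h6 := rpow_sub_one_sq (p := p) hs0
    set e := s ^ (r - p)
    set F := tailInt (nonlin p r) s
    have he0 : 0 < e := by positivity
    have a1 : 0 < s ^ p := by positivity
    have a2 : 0 < s ^ (p - 2) := by positivity
    have a3 : 0 < s ^ (p - 1) := by positivity
    have hp1 : p - 1 ≠ 0 := by linarith
    have b1 : (p - 1) * (s ^ (p - 1) * (p + r * e) * F) = p := by
      field_simp at h5
      linarith
    have b2 : s ^ (p - 2) * (p * (p - 1) + r * (r - 1) * e) * F * (s ^ p * (1 + e)) =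
        s ^ (p - 1) * (p + r * e) := by
      have c : s ^ p * (1 + e) ≠ 0 := by positivity
      field_simp at h4
      linarith
    have b3 : p * (1 + e) * (p * (p - 1) + r * (r - 1) * e) = (p - 1) * (p + r * e) ^ 2 := by
      have c1 : s ^ p * s ^ (p - 2) * (p * (1 + e) * (p * (p - 1) + r * (r - 1) * e)) =
          s ^ p * s ^ (p - 2) * ((p - 1) * (p + r * e) ^ 2) := by
        linear_combination (p - 1) * (s ^ (p - 1) * (p + r * e)) * b2 +
          (p - 1) * (p + r * e) ^ 2 * h6 -
          s ^ p * s ^ (p - 2) * (1 + e) * (p * (p - 1) + r * (r - 1) * e) * b1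
      exact mul_left_cancel₀ (by positivity) c1
    have b4 : e * (p - r) * (p * (p - r - 1) - r * e) = 0 := by linear_combination b3
    have b5 : e * (p - r) ≠ 0 := mul_ne_zero he0.ne' (by linarith)
    have b6 := (mul_eq_zero.1 b4).resolve_left b5
    linarith
  set s₁ := max S 0 + 1 with hs₁
  have hs₁0 : 0 < s₁ := by positivity
  have h1 := key s₁ (by linarith)
  have h2 := key (s₁ + 1) (by linarith)
  have h3 : (s₁ + 1) ^ (r - p) < s₁ ^ (r - p) :=
    Real.rpow_lt_rpow_of_neg hs₁0 (by linarith) (by linarith)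
  have := mul_lt_mul_of_pos_left h3 hr
  linarith

/-- Decay of `s ^ (r - p)` along the inverse of the tail integral. -/
lemma rpow_tailInv_le (hp : 1 < p) (hrp : r < p) {y : ℝ} (hy : 0 < y)
    (hy1 : y ≤ tailInt (nonlin p r) 1) :
    tailInv (nonlin p r) y ^ (r - p) ≤ (2 * (p - 1) * y) ^ ((p - r) / (p - 1)) := by
  obtain ⟨h1, h2⟩ := tailInv_spec hp hrp hy hy1
  set s := tailInv (nonlin p r) y
  have hs : 0 < s := zero_lt_one.trans_le h1
  have hp1 : 0 < p - 1 := by linarith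
  have he : s ^ (r - p) ≤ 1 := Real.rpow_le_one_of_one_le_of_nonpos h1 (by linarith)
  have h3 := le_tailInt hp hrp hs
  rw [h2, div_le_iff₀ (by positivity), div_le_iff₀ hp1] at h3
  -- The factor 2 bounds 1 + s^(r-p).
  have h4 : s ^ (1 - p) ≤ 2 * (p - 1) * y := by
    refine h3.trans ?_
    nlinarith [mul_pos hy hp1]
  have e : s ^ (r - p) = (s ^ (1 - p)) ^ ((p - r) / (p - 1)) := by
    rw [← Real.rpow_mul hs.le]
    congr 1
    field_simp
    ring
  rw [e]
  exact Real.rpow_le_rpow (by positivity) h4 (div_nonneg (by linarith) hp1.le)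

end Nonlin

/-! The perturbation of the linear oscillator. -/

/-- The remainder `(1 + x) ^ c - 1 - c x`. -/
noncomputable def powRemainder (c x : ℝ) : ℝ := (1 + x) ^ c - 1 - c * x

lemma hasDerivAt_one_add_rpow (c : ℝ) {x : ℝ} (hx : -1 < x) :
    HasDerivAt (fun x => (1 + x) ^ c) (c * (1 + x) ^ (c - 1)) x := by
  have := (Real.hasDerivAt_rpow_const (p := c) (Or.inl (by linarith : (1 + x) ≠ 0))).comp x
    ((hasDerivAt_id x).const_add 1)
  simpa [Function.comp_def] using this

/-- The derivative c((1+x)^(c-1) - 1) vanishes at 0, so the mean value inequality, used twice,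
yields the small factor m. The range |x| ≤ 1/2 keeps 1 + x away from 0, so any real exponent is
allowed. -/
lemma exists_powRemainder_lipschitz (c : ℝ) :
    ∃ C, 0 ≤ C ∧ ∀ m x x', m ≤ 1 / 2 → |x| ≤ m → |x'| ≤ m →
      |powRemainder c x - powRemainder c x'| ≤ C * m * |x - x'| := by
  obtain ⟨B, hB⟩ := (isCompact_Icc (a := -(1 / 2 : ℝ)) (b := 1 / 2)).exists_bound_of_continuousOn
    (f := fun x => (c - 1) * (1 + x) ^ (c - 1 - 1)) (fun x hx => by
      have : 1 + x ≠ 0 := by linarith [hx.1]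
      exact (continuousAt_const.mul ((continuousAt_const.add continuousAt_id).rpow_const
        (Or.inl this))).continuousWithinAt)
  have hB0 : 0 ≤ B := (norm_nonneg _).trans (hB 0 (by norm_num))
  have h1 : ∀ x ∈ Icc (-(1 / 2 : ℝ)) (1 / 2), |(1 + x) ^ (c - 1) - 1| ≤ B * |x| := by
    intro x hx
    have := (convex_Icc (-(1 / 2 : ℝ)) (1 / 2)).norm_image_sub_le_of_norm_hasDerivWithin_le
      (f := fun x => (1 + x) ^ (c - 1)) (C := B) (x := 0) (y := x)
      (fun y hy => (hasDerivAt_one_add_rpow (c - 1) (by linarith [hy.1])).hasDerivWithinAt)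
      hB (by norm_num) hx
    simpa using this
  refine ⟨|c| * B, by positivity, fun m x x' hm hx hx' => ?_⟩
  have hsub : ∀ y ∈ Icc (-m) m, y ∈ Icc (-(1 / 2 : ℝ)) (1 / 2) := fun y hy =>
    ⟨by linarith [hy.1], by linarith [hy.2]⟩
  have h2 := (convex_Icc (-m) m).norm_image_sub_le_of_norm_hasDerivWithin_le
    (f := powRemainder c) (f' := fun y => c * (1 + y) ^ (c - 1) - c) (C := |c| * B * m)
    (x := x') (y := x) (fun y hy => by
      have hy' := hsub y hy
      refine HasDerivAt.hasDerivWithinAt ?_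
      have := ((hasDerivAt_one_add_rpow c (by linarith [hy'.1])).sub_const 1).sub
        ((hasDerivAt_id y).const_mul c)
      exact this.congr_deriv (by ring)) (fun y hy => by
      rw [Real.norm_eq_abs, show c * (1 + y) ^ (c - 1) - c = c * ((1 + y) ^ (c - 1) - 1) by ring,
        abs_mul, mul_assoc]
      refine mul_le_mul_of_nonneg_left ((h1 y (hsub y hy)).trans ?_) (abs_nonneg _)
      exact mul_le_mul_of_nonneg_left (abs_le.2 hy) hB0) (abs_le.1 hx') (abs_le.1 hx)
  simpa using h2

/-- The right-hand side of the equation for the relative perturbation; `κ`, `w`, `h` are the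
values of `tailRatio`, `lowerShare` and `holderDefect`. -/
noncomputable def perturbation (b p r κ w h x y : ℝ) : ℝ :=
  -4 * (κ - 1 / (p - 1)) * y - b * ((p - 1) * κ - 1) * x + b * κ * w * (p - r) * x
    - b * κ * ((1 - w) * powRemainder p x + w * powRemainder r x) - 4 * κ * (1 + x) * h

/-- The linear coefficients are O(e) and the power remainders contribute m. At the origin only -4κh
is left, so the source is bounded by |h| itself and not merely by e; this is why the final estimate
involves the defect. -/
lemma exists_perturbation_lipschitz {b p r : ℝ} (hb : 0 < b) (hp : 1 < p) (hrp : r < p)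
    {c : ℝ} (hc : 0 ≤ c) :
    ∃ C, 0 < C ∧ ∀ κ w h e m, 0 ≤ (p - 1) * κ - 1 → (p - 1) * κ - 1 ≤ e → e ≤ 1 →
      0 ≤ w → w ≤ 1 → w ≤ e → |h| ≤ c * e →
      |perturbation b p r κ w h 0 0| ≤ C * |h| ∧
      (m ≤ 1 / 2 → ∀ x y x' y', |x| ≤ m → |x'| ≤ m →
        |perturbation b p r κ w h x y - perturbation b p r κ w h x' y'| ≤
          C * (e + m) * max |x - x'| |y - y'|) := by
  obtain ⟨C₁, hC₁, h1⟩ := exists_powRemainder_lipschitz p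
  obtain ⟨C₂, hC₂, h2⟩ := exists_powRemainder_lipschitz r
  have hp1 : 0 < p - 1 := by linarith
  set k := 2 / (p - 1) with hk
  have hk0 : 0 < k := by positivity
  -- One summand for each term of the perturbation, the last one for the source; k bounds κ because
  -- e ≤ 1.
  refine ⟨2 * k + b + b * k * (p - r) + b * k * (C₁ + C₂) + 4 * k * c + 4 * k, by
    have : 0 < b * k * (p - r) := mul_pos (mul_pos hb hk0) (by linarith)
    positivity, ?_⟩
  intro κ w h e m hκ0 hκe he1 hw0 hw1 hwe hh
  have he0 : 0 ≤ e := hκ0.trans hκe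
  have hκk : κ ≤ k := by rw [hk, le_div_iff₀ hp1]; linarith
  have hκ : 0 ≤ κ := by
    by_contra! hneg
    nlinarith
  have hpr : 0 < p - r := by linarith
  have hrest : 0 ≤ 2 * k + b + b * k * (p - r) + b * k * (C₁ + C₂) + 4 * k * c := by positivity
  constructor
  · have e0 : perturbation b p r κ w h 0 0 = -(4 * κ * h) := by
      simp [perturbation, powRemainder]
    rw [e0, abs_neg, abs_mul, abs_of_nonneg (by positivity : 0 ≤ 4 * κ)]
    refine mul_le_mul_of_nonneg_right ?_ (abs_nonneg _)
    linarith
  · intro hm x y x' y' hx hx'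
    have hm0 : 0 ≤ m := (abs_nonneg _).trans hx
    set D := max |x - x'| |y - y'| with hD
    have hDx : |x - x'| ≤ D := le_max_left _ _
    have hDy : |y - y'| ≤ D := le_max_right _ _
    have hD0 : 0 ≤ D := (abs_nonneg _).trans hDx
    have t1 : |4 * (κ - 1 / (p - 1)) * (y - y')| ≤ 2 * k * e * D := by
      have e1 : 4 * (κ - 1 / (p - 1)) = 2 * k * ((p - 1) * κ - 1) := by
        rw [hk]; field_simp; ring
      rw [e1, abs_mul, abs_of_nonneg (by positivity)]
      exact mul_le_mul (mul_le_mul_of_nonneg_left hκe (by positivity)) hDy (abs_nonneg _)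
        (by positivity)
    have t2 : |b * ((p - 1) * κ - 1) * (x - x')| ≤ b * e * D := by
      rw [abs_mul, abs_of_nonneg (by positivity)]
      exact mul_le_mul (mul_le_mul_of_nonneg_left hκe hb.le) hDx (abs_nonneg _)
        (by positivity)
    have t3 : |b * κ * w * (p - r) * (x - x')| ≤ b * k * (p - r) * e * D := by
      rw [abs_mul, abs_of_nonneg (by positivity)]
      refine mul_le_mul ?_ hDx (abs_nonneg _) (by positivity)
      have : κ * w ≤ k * e := mul_le_mul hκk hwe hw0 hk0.le
      have := mul_le_mul_of_nonneg_left this (mul_pos hb hpr).le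
      linarith
    have t4 : |b * κ * ((1 - w) * (powRemainder p x - powRemainder p x') +
        w * (powRemainder r x - powRemainder r x'))| ≤ b * k * (C₁ + C₂) * m * D := by
      have a1 : |(1 - w) * (powRemainder p x - powRemainder p x')| ≤ C₁ * m * D := by
        rw [abs_mul, abs_of_nonneg (by linarith : 0 ≤ 1 - w)]
        have a2 := (h1 m x x' hm hx hx').trans (mul_le_mul_of_nonneg_left hDx (by positivity))
        calc (1 - w) * |powRemainder p x - powRemainder p x'| ≤
            1 * |powRemainder p x - powRemainder p x'| :=
              mul_le_mul_of_nonneg_right (by linarith) (abs_nonneg _)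
          _ ≤ _ := by rw [one_mul]; exact a2
      have a2 : |w * (powRemainder r x - powRemainder r x')| ≤ C₂ * m * D := by
        rw [abs_mul, abs_of_nonneg hw0]
        have a2 := (h2 m x x' hm hx hx').trans (mul_le_mul_of_nonneg_left hDx (by positivity))
        calc w * |powRemainder r x - powRemainder r x'| ≤
            1 * |powRemainder r x - powRemainder r x'| :=
              mul_le_mul_of_nonneg_right hw1 (abs_nonneg _)
          _ ≤ _ := by rw [one_mul]; exact a2
      have a3 := (abs_add_le _ _).trans (add_le_add a1 a2)
      rw [abs_mul, abs_of_nonneg (by positivity)]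
      calc _ ≤ b * k * (C₁ * m * D + C₂ * m * D) :=
            mul_le_mul (mul_le_mul_of_nonneg_left hκk hb.le) a3 (abs_nonneg _) (by positivity)
        _ = _ := by ring
    have t5 : |4 * κ * h * (x - x')| ≤ 4 * k * c * e * D := by
      rw [abs_mul, abs_mul, abs_of_nonneg (by positivity : 0 ≤ 4 * κ)]
      refine mul_le_mul ?_ hDx (abs_nonneg _) (by positivity)
      have : κ * |h| ≤ k * (c * e) := mul_le_mul hκk hh (abs_nonneg _) hk0.le
      linarith
    have e0 : perturbation b p r κ w h x y - perturbation b p r κ w h x' y' =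
        -(4 * (κ - 1 / (p - 1)) * (y - y')) - b * ((p - 1) * κ - 1) * (x - x')
        + b * κ * w * (p - r) * (x - x')
        - b * κ * ((1 - w) * (powRemainder p x - powRemainder p x') +
          w * (powRemainder r x - powRemainder r x')) - 4 * κ * h * (x - x') := by
      unfold perturbation
      ring
    have hfin : 2 * k * e * D + b * e * D + b * k * (p - r) * e * D + b * k * (C₁ + C₂) * m * D +
        4 * k * c * e * D ≤ (2 * k + b + b * k * (p - r) + b * k * (C₁ + C₂) + 4 * k * c + 4 * k) *
          (e + m) * D := by
      have s1 : 0 ≤ b * k * (C₁ + C₂) * (e * D) := by positivity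
      have s2 : 0 ≤ (2 * k + b + b * k * (p - r) + 4 * k * c) * (m * D) := by positivity
      have s3 : 0 ≤ 4 * k * ((e + m) * D) := by positivity
      nlinarith
    refine le_trans ?_ hfin
    rw [e0]
    rw [abs_le] at *
    constructor <;> linarith

/-! The Laplacian of a function of `‖x‖ ^ 2`. -/

/-- The Hessian is 4W'' x⊗x + 2W' I; take its trace. Using the squared radius avoids differentiating
the norm. -/
lemma laplacian_comp_norm_sq {N : ℕ} {W W' : ℝ → ℝ} {W'' : ℝ} {x : EuclideanSpace ℝ (Fin N)}
    (h1 : ∀ᶠ y in 𝓝 (‖x‖ ^ 2), HasDerivAt W (W' y) y) (h2 : HasDerivAt W' W'' (‖x‖ ^ 2)) :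
    Laplacian.laplacian (fun z : EuclideanSpace ℝ (Fin N) => W (‖z‖ ^ 2)) x =
      4 * ‖x‖ ^ 2 * W'' + 2 * N * W' (‖x‖ ^ 2) := by
  have hn : ∀ z : EuclideanSpace ℝ (Fin N),
      HasFDerivAt (fun z : EuclideanSpace ℝ (Fin N) => ‖z‖ ^ 2) (2 • innerSL ℝ z) z := fun z =>
    (hasStrictFDerivAt_norm_sq z).hasFDerivAt
  have hf : fderiv ℝ (fun z : EuclideanSpace ℝ (Fin N) => W (‖z‖ ^ 2)) =ᶠ[𝓝 x]
      fun z => W' (‖z‖ ^ 2) • (2 • innerSL ℝ z) := by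
    have hc : ContinuousAt (fun z : EuclideanSpace ℝ (Fin N) => ‖z‖ ^ 2) x := by fun_prop
    filter_upwards [hc.eventually h1] with z hz
    exact (hz.comp_hasFDerivAt z (hn z)).fderiv
  have hL : HasFDerivAt (fun z : EuclideanSpace ℝ (Fin N) => 2 • innerSL ℝ z)
      (2 • innerSL ℝ : EuclideanSpace ℝ (Fin N) →L[ℝ] EuclideanSpace ℝ (Fin N) →L[ℝ] ℝ) x :=
    (2 • innerSL ℝ : EuclideanSpace ℝ (Fin N) →L[ℝ] EuclideanSpace ℝ (Fin N) →L[ℝ] ℝ).hasFDerivAt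
  have hs := (h2.comp_hasFDerivAt x (hn x)).smul hL
  rw [InnerProductSpace.laplacian_eq_iteratedFDeriv_orthonormalBasis _
    (EuclideanSpace.basisFun (Fin N) ℝ)]
  simp only [iteratedFDeriv_two_apply]
  have hs' : fderiv ℝ (fun z : EuclideanSpace ℝ (Fin N) => W' (‖z‖ ^ 2) • (2 • innerSL ℝ z)) x = _ :=
    HasFDerivAt.fderiv hs
  rw [hf.fderiv_eq, hs']
  have hx : ‖x‖ ^ 2 = ∑ i, x i ^ 2 := by
    rw [EuclideanSpace.norm_sq_eq]; simp
  have hterm : ∀ i : Fin N, ((W' ∘ fun z : EuclideanSpace ℝ (Fin N) => ‖z‖ ^ 2) x • (2 • innerSL ℝ :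
      EuclideanSpace ℝ (Fin N) →L[ℝ] EuclideanSpace ℝ (Fin N) →L[ℝ] ℝ) +
      (W'' • 2 • innerSL ℝ x).smulRight (2 • innerSL ℝ x))
      (EuclideanSpace.basisFun (Fin N) ℝ i) (EuclideanSpace.basisFun (Fin N) ℝ i) =
      2 * W' (‖x‖ ^ 2) + 4 * W'' * x i ^ 2 := by
    intro i
    have hin : innerSL ℝ (EuclideanSpace.single i (1 : ℝ)) (EuclideanSpace.single i (1 : ℝ)) =
        (1 : ℝ) := by
      rw [innerSL_apply_apply]; simp
    simp only [Function.comp_apply, EuclideanSpace.basisFun_apply, add_apply,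
      smul_apply, ContinuousLinearMap.smulRight_apply, innerSL_apply_apply,
      EuclideanSpace.inner_single_right, smul_eq_mul, nsmul_eq_mul]
    simp [hin]
    ring
  simp only [Matrix.cons_val_zero, Matrix.cons_val_one, hterm]
  rw [Finset.sum_add_distrib, ← Finset.mul_sum, ← Finset.mul_sum, ← hx]
  simp
  ring

/-! Exponents. -/

section Exponents

variable {N : ℕ} {p r : ℝ}

lemma one_lt_of_pCrit_lt (hN : 3 ≤ N) (hp : pCrit N < p) : 1 < p := by
  have h : (3 : ℝ) ≤ N := by exact_mod_cast hN
  refine lt_trans ?_ hp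
  rw [pCrit, lt_div_iff₀ (by linarith)]
  linarith

lemma two_div_lt_of_pCrit_lt (hN : 3 ≤ N) (hp : pCrit N < p) : 2 / (p - 1) < N - 2 := by
  have h : (3 : ℝ) ≤ N := by exact_mod_cast hN
  have h1 := one_lt_of_pCrit_lt hN hp
  rw [pCrit, div_lt_iff₀ (by linarith)] at hp
  rw [div_lt_iff₀ (by linarith)]
  nlinarith

/-- The quantity is 2(N - 2 - 2/(p-1)), so this is where p > p_c enters. -/
lemma two_mul_sub_pos (hN : 3 ≤ N) (hp : pCrit N < p) : 0 < 2 * (N : ℝ) - 4 * (p / (p - 1)) := by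
  have h1 := one_lt_of_pCrit_lt hN hp
  have h2 := two_div_lt_of_pCrit_lt hN hp
  have e : p / (p - 1) = 1 + 2 / (p - 1) / 2 := by
    have : p - 1 ≠ 0 := by linarith
    field_simp
    ring
  rw [e]
  linarith

lemma coeffA_pos (hN : 3 ≤ N) (hp1 : 1 < p) (hp : p < pSobolev N) : 0 < coeffA N p := by
  have h : (3 : ℝ) ≤ N := by exact_mod_cast hN
  rw [pSobolev, lt_div_iff₀ (by linarith)] at hp
  have h2 : (N : ℝ) - 2 < 4 / (p - 1) := by
    rw [lt_div_iff₀ (by linarith)]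
    nlinarith
  unfold coeffA
  linarith

lemma discr_eq (hp1 : 1 < p) :
    discr N p = coeffA N p ^ 2 - 4 * (2 * (N : ℝ) - 4 * (p / (p - 1))) := by
  have : p - 1 ≠ 0 := by linarith
  rw [discr, coeffA]
  field_simp
  ring

lemma pStar_sub_one_pos (hN : 3 ≤ N) : 0 < (N : ℝ) - 4 + 2 * √((N : ℝ) - 1) := by
  have h : (3 : ℝ) ≤ N := by exact_mod_cast hN
  have : 1 < √((N : ℝ) - 1) := Real.lt_sqrt_of_sq_lt (by linarith)
  linarith

/-- The discriminant factors through `m = 2 / (p - 1)`, with larger root `2 / (p_* - 1)`. -/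
lemma discr_factor (hN : 3 ≤ N) :
    discr N p = 4 * (2 / (p - 1) - 2 / (pStar N - 1)) *
      (2 / (p - 1) - ((N : ℝ) - 4 - 2 * √((N : ℝ) - 1)) / 2) := by
  have h : (3 : ℝ) ≤ N := by exact_mod_cast hN
  have h1 := pStar_sub_one_pos hN
  have e : 2 / (pStar N - 1) = ((N : ℝ) - 4 + 2 * √((N : ℝ) - 1)) / 2 := by
    rw [pStar]
    field_simp
    ring
  have hs : √((N : ℝ) - 1) ^ 2 = N - 1 := Real.sq_sqrt (by linarith)
  rw [e, discr, show 4 / (p - 1) = 2 * (2 / (p - 1)) by ring]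
  linear_combination 4 * hs

/-- Positivity of a means 2/(p-1) > (N-2)/2, which exceeds the smaller root. The sign of the
discriminant is therefore decided by p_* alone. -/
lemma discr_second_factor_pos (hN : 3 ≤ N) (ha : 0 < coeffA N p) :
    0 < 2 / (p - 1) - ((N : ℝ) - 4 - 2 * √((N : ℝ) - 1)) / 2 := by
  have h : (3 : ℝ) ≤ N := by exact_mod_cast hN
  have : 0 < √((N : ℝ) - 1) := Real.sqrt_pos.2 (by linarith)
  rw [coeffA, show 4 / (p - 1) = 2 * (2 / (p - 1)) by ring] at ha
  linarith

lemma one_lt_pStar (hN : 3 ≤ N) : 1 < pStar N := by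
  rw [pStar]
  have := div_pos (four_pos (α := ℝ)) (pStar_sub_one_pos hN)
  linarith

lemma discr_pos (hN : 3 ≤ N) (hp1 : 1 < p) (ha : 0 < coeffA N p) (h : p < pStar N) :
    0 < discr N p := by
  rw [discr_factor hN]
  have : 2 / (pStar N - 1) < 2 / (p - 1) :=
    div_lt_div_of_pos_left two_pos (by linarith) (by linarith)
  exact mul_pos (by linarith) (discr_second_factor_pos hN ha)

lemma discr_pStar (hN : 3 ≤ N) : discr N (pStar N) = 0 := by
  rw [discr_factor hN]
  simp

lemma discr_neg (hN : 3 ≤ N) (ha : 0 < coeffA N p) (h : pStar N < p) :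
    discr N p < 0 := by
  have := one_lt_pStar hN
  rw [discr_factor hN]
  have : 2 / (p - 1) < 2 / (pStar N - 1) :=
    div_lt_div_of_pos_left two_pos (by linarith) (by linarith)
  exact mul_neg_of_neg_of_pos (by linarith) (discr_second_factor_pos hN ha)

/-- The order of the logarithmic factor in the kernel. -/
noncomputable def kernelLogOrder (N : ℕ) (p : ℝ) : ℕ := if p = pStar N then 1 else 0

/-- The exponential rate of the kernel. -/
noncomputable def kernelRate (N : ℕ) (p : ℝ) : ℝ :=
  if p < pStar N then lam1 N p else coeffA N p / 2

lemma lamStar_eq : lamStar N = coeffA N (pStar N) / 2 := by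
  rw [lamStar, coeffA]; ring

lemma kernelRate_pos (hN : 3 ≤ N) (hp : pCrit N < p) (hp' : p < pSobolev N) :
    0 < kernelRate N p := by
  have hp1 := one_lt_of_pCrit_lt hN hp
  have ha := coeffA_pos hN hp1 hp'
  have hb := two_mul_sub_pos hN hp
  rw [kernelRate]
  split_ifs with h
  · have : √(discr N p) < coeffA N p := by
      rw [Real.sqrt_lt' ha, discr_eq hp1]
      linarith
    rw [lam1]
    linarith
  · linarith

lemma exists_kernel_fundamentalSolution (hN : 3 ≤ N) (hp : pCrit N < p) (hp' : p < pSobolev N) :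
    ∃ (k k' : ℝ → ℝ) (C : ℝ), 0 < C ∧
      IsFundamentalSolution (coeffA N p) (2 * (N : ℝ) - 4 * (p / (p - 1))) k k' ∧ ∀ t, 0 ≤ t →
      |k t| ≤ C * decayKernel (kernelLogOrder N p) (kernelRate N p) t ∧
      |k' t| ≤ C * decayKernel (kernelLogOrder N p) (kernelRate N p) t := by
  have hp1 := one_lt_of_pCrit_lt hN hp
  have ha := coeffA_pos hN hp1 hp'
  have hb := two_mul_sub_pos hN hp
  have hd := discr_eq (N := N) hp1
  rw [kernelLogOrder, kernelRate]
  rcases lt_trichotomy p (pStar N) with h | h | h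
  · rw [if_neg h.ne, if_pos h, lam1, hd]
    have := discr_pos hN hp1 ha h
    simpa using exists_fundamentalSolution_of_pos ha hb (hd ▸ this)
  · rw [if_pos h, if_neg h.not_lt]
    have := discr_pStar hN
    rw [← h] at this
    simpa using exists_fundamentalSolution_of_eq ha (hd ▸ this)
  · rw [if_neg h.ne', if_neg h.not_gt]
    have := discr_neg hN ha h
    simpa using exists_fundamentalSolution_of_neg ha (hd ▸ this)

lemma div_rpow_eq_exp {ρ s : ℝ} (hρ : 0 < ρ) (hs : 0 < s) (l : ℝ) :
    (ρ / s) ^ l = Real.exp (-(l * Real.log (s / ρ))) := by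
  rw [Real.rpow_def_of_pos (div_pos hρ hs), ← inv_div s ρ, Real.log_inv]
  congr 1
  ring

/-- This merges the three cases into one translation-invariant kernel in logarithmic time. -/
lemma kernelP_eq {ρ s : ℝ} (hρ : 0 < ρ) (hs : 0 < s) :
    kernelP N p ρ s =
      decayKernel (kernelLogOrder N p) (kernelRate N p) (Real.log (s / ρ)) := by
  rw [kernelP, kernelLogOrder, kernelRate, decayKernel]
  rcases lt_trichotomy p (pStar N) with h | h | h
  · rw [if_pos h, if_neg h.ne, if_pos h, div_rpow_eq_exp hρ hs]
    simp
  · rw [if_neg h.not_lt, if_pos h, if_pos h, if_neg h.not_lt, div_rpow_eq_exp hρ hs, lamStar_eq,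
      ← h]
    simp
  · rw [if_neg h.not_gt, if_neg h.ne', if_neg h.ne', if_neg h.not_gt, div_rpow_eq_exp hρ hs]
    simp

/-- The threshold compares two rates: r < r* exactly when the forcing rate μ exceeds the kernel
rate. -/
lemma rStar_sub (hp1 : 1 < p) :
    rStar N p - r = (p - 1) / 2 * (2 * (p - r) / (p - 1) - kernelRate N p) := by
  have : p - 1 ≠ 0 := by linarith
  rw [rStar, kernelRate]
  split_ifs with h
  · rw [lam1, coeffA]
    field_simp
    ring
  · rw [coeffA]
    field_simp
    ring

lemma decayBound_eq (hp1 : 1 < p) (ρ : ℝ) :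
    decayBound N p r ρ =
      if kernelRate N p < 2 * (p - r) / (p - 1) then
        ρ ^ kernelRate N p * Real.log (1 / ρ) ^ kernelLogOrder N p
      else if kernelRate N p = 2 * (p - r) / (p - 1) then
        ρ ^ kernelRate N p * Real.log (1 / ρ) ^ (kernelLogOrder N p + 1)
      else ρ ^ (2 * (p - r) / (p - 1)) := by
  have h := rStar_sub (N := N) (r := r) hp1
  have hc : 0 < (p - 1) / 2 := by linarith
  have h1 : r < rStar N p ↔ kernelRate N p < 2 * (p - r) / (p - 1) := by
    rw [← sub_pos, h, mul_pos_iff_of_pos_left hc, sub_pos]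
  have h2 : r = rStar N p ↔ kernelRate N p = 2 * (p - r) / (p - 1) := by
    rw [eq_comm, ← sub_eq_zero, h, mul_eq_zero, or_iff_right hc.ne', sub_eq_zero, eq_comm]
  rw [decayBound]
  simp only [h1, h2]
  have h3 : (if p < pStar N then ρ ^ lam1 N p
      else if p = pStar N then ρ ^ lamStar N * Real.log (1 / ρ)
      else ρ ^ (coeffA N p / 2)) = ρ ^ kernelRate N p * Real.log (1 / ρ) ^ kernelLogOrder N p := by
    rw [kernelRate, kernelLogOrder]
    rcases lt_trichotomy p (pStar N) with h | h | h
    · simp [h, h.ne]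
    · rw [if_neg h.not_lt, if_pos h, if_neg h.not_lt, if_pos h, lamStar_eq, ← h, pow_one]
    · simp [h.not_gt, h.ne']
  have h4 : (if p < pStar N then ρ ^ lam1 N p * Real.log (1 / ρ)
      else if p = pStar N then ρ ^ lamStar N * Real.log (1 / ρ) ^ 2
      else ρ ^ (coeffA N p / 2) * Real.log (1 / ρ)) =
        ρ ^ kernelRate N p * Real.log (1 / ρ) ^ (kernelLogOrder N p + 1) := by
    rw [kernelRate, kernelLogOrder]
    rcases lt_trichotomy p (pStar N) with h | h | h
    · simp [h, h.ne]
    · rw [if_neg h.not_lt, if_pos h, if_neg h.not_lt, if_pos h, lamStar_eq, ← h]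
    · simp [h.not_gt, h.ne']
  rw [h3, h4]

lemma kernelLogOrder_le_one : (kernelLogOrder N p : ℝ) ≤ 1 := by
  rw [kernelLogOrder]
  split_ifs <;> simp

/-- The weight at `t = log (r₀ / ρ)` is controlled by the explicit comparison function. -/
lemma decayWeight_isBigO_decayBound (hp1 : 1 < p) {H : ℝ → ℝ} {B c r₀ : ℝ}
    (hH : Continuous H) (hr₀ : 0 < r₀) (hr₀1 : r₀ ≤ 1)
    (hc : 0 ≤ c) (hB : 0 ≤ B)
    (hHB : ∀ s, 0 ≤ s → H s ≤ B * Real.exp (-(2 * (p - r) / (p - 1) * s))) :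
    ∃ C, ∀ᶠ ρ in 𝓝[>] (0 : ℝ),
      decayWeight (kernelLogOrder N p) (kernelRate N p) c H (Real.log (r₀ / ρ)) ≤
        C * decayBound N p r ρ := by
  set l := kernelRate N p with hl
  set J := kernelLogOrder N p with hJ
  set μ := 2 * (p - r) / (p - 1) with hμ
  have hj : (0 : ℝ) ≤ J := Nat.cast_nonneg _
  have hj1 : (J : ℝ) ≤ 1 := kernelLogOrder_le_one
  have hJ1 : J ≤ 1 := by exact_mod_cast hj1
  -- Once log(1/ρ) ≥ 1, additive constants are absorbed into powers of the logarithm.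
  have hlarge : ∀ᶠ ρ in 𝓝[>] (0 : ℝ), 0 < ρ ∧ ρ < r₀ ∧ 1 ≤ Real.log (1 / ρ) := by
    filter_upwards [self_mem_nhdsWithin, mem_nhdsWithin_of_mem_nhds (gt_mem_nhds hr₀),
      mem_nhdsWithin_of_mem_nhds (gt_mem_nhds (Real.exp_pos (-1)))] with ρ h1 h2 h3
    refine ⟨h1, h2, ?_⟩
    rw [one_div, Real.log_inv]
    have := Real.log_lt_log h1 h3
    rw [Real.log_exp] at this
    linarith
  have hexp : ∀ (ν : ℝ) {ρ : ℝ}, 0 < ρ →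
      Real.exp (-(ν * Real.log (r₀ / ρ))) = r₀ ^ (-ν) * ρ ^ ν := by
    intro ν ρ hρ
    rw [← div_rpow_eq_exp hρ hr₀, Real.div_rpow hρ.le hr₀.le, Real.rpow_neg hr₀.le]
    field_simp
  have htl : ∀ {ρ : ℝ}, 0 < ρ → Real.log (r₀ / ρ) ≤ Real.log (1 / ρ) := fun hρ =>
    Real.log_le_log (div_pos hr₀ hρ) (div_le_div_of_nonneg_right hr₀1 hρ.le)
  have hK : ∀ {ρ : ℝ}, 0 < ρ → ρ < r₀ → 1 ≤ Real.log (1 / ρ) →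
      decayKernel J l (Real.log (r₀ / ρ)) ≤
        2 * r₀ ^ (-l) * (ρ ^ l * Real.log (1 / ρ) ^ J) := by
    intro ρ hρ hρr hlog
    have h1 : 1 + (J : ℝ) * Real.log (r₀ / ρ) ≤ 2 * Real.log (1 / ρ) ^ J := by
      rcases Nat.le_one_iff_eq_zero_or_eq_one.1 hJ1 with h | h
      · simp [h]
      · rw [h, pow_one, Nat.cast_one]
        linarith [htl hρ]
    rw [decayKernel, hexp l hρ]
    have := mul_le_mul_of_nonneg_right h1 (show 0 ≤ r₀ ^ (-l) * ρ ^ l by positivity)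
    linarith
  have hconv : ∀ {t : ℝ}, 0 ≤ t → decayConv J l H t ≤
      B * decayConv J l (fun s => Real.exp (-(μ * s))) t := fun ht => by
    rw [← decayConv_const_mul]
    exact decayConv_mono hj hH (by fun_prop) hHB ht
  have ht0 : ∀ {ρ : ℝ}, 0 < ρ → ρ < r₀ → 0 ≤ Real.log (r₀ / ρ) := fun hρ hρr =>
    Real.log_nonneg ((one_le_div hρ).2 hρr.le)
  rcases lt_trichotomy l μ with h | h | h
  · refine ⟨(c + B * (1 / (μ - l))) * (2 * r₀ ^ (-l)), ?_⟩
    filter_upwards [hlarge] with ρ ⟨hρ, hρr, hlog⟩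
    rw [decayBound_eq hp1, ← hl, ← hJ, ← hμ, if_pos h, decayWeight]
    have h1 := hconv (ht0 hρ hρr)
    have h2 := mul_le_mul_of_nonneg_left (decayConv_exp_le_of_gt hj h (ht0 hρ hρr)) hB
    have hnn : 0 ≤ c + B * (1 / (μ - l)) := by
      have : 0 < 1 / (μ - l) := one_div_pos.2 (sub_pos.2 h)
      positivity
    have h3 := mul_le_mul_of_nonneg_left (hK hρ hρr hlog) hnn
    linarith
  · refine ⟨(c + B) * (2 * r₀ ^ (-l)), ?_⟩
    filter_upwards [hlarge] with ρ ⟨hρ, hρr, hlog⟩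
    rw [decayBound_eq hp1, ← hl, ← hJ, ← hμ, if_neg h.not_lt, if_pos h, decayWeight]
    have h1 := hconv (ht0 hρ hρr)
    rw [← h] at h1
    have h2 := mul_le_mul_of_nonneg_left (decayConv_exp_le_of_eq (l := l) hj (ht0 hρ hρr)) hB
    have h3 := hK hρ hρr hlog
    have hnn := (decayKernel_pos (l := l) hj (ht0 hρ hρr)).le
    set t := Real.log (r₀ / ρ)
    set ℓ := Real.log (1 / ρ)
    have h4 : t * decayKernel J l t ≤ ℓ * decayKernel J l t :=
      mul_le_mul_of_nonneg_right (htl hρ) hnn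
    have h5 : decayKernel J l t ≤ ℓ * decayKernel J l t := by nlinarith
    have h6 : ℓ * decayKernel J l t ≤ ℓ * (2 * r₀ ^ (-l) * (ρ ^ l * ℓ ^ J)) :=
      mul_le_mul_of_nonneg_left h3 (by linarith)
    have h7 := mul_le_mul_of_nonneg_left (h5.trans h6) hc
    have h8 := mul_le_mul_of_nonneg_left (h4.trans h6) hB
    rw [pow_succ]
    linarith
  · refine ⟨(c * (1 + 1 / (l - μ)) + B * ((1 + 2 / (l - μ)) * (2 / (l - μ)))) * r₀ ^ (-μ), ?_⟩
    filter_upwards [hlarge] with ρ ⟨hρ, hρr, hlog⟩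
    rw [decayBound_eq hp1, ← hl, ← hJ, ← hμ, if_neg h.not_gt, if_neg h.ne', decayWeight]
    have h1 := hconv (ht0 hρ hρr)
    have h2 := mul_le_mul_of_nonneg_left (decayConv_exp_le_of_lt hj1 h (ht0 hρ hρr)) hB
    have h3 := mul_le_mul_of_nonneg_left (decayKernel_le_exp hj1 h (ht0 hρ hρr)) hc
    rw [hexp μ hρ] at h2 h3
    linarith

end Exponents

/-! The logarithmic time `t = log (r₀ / ρ)` and the existence of the relative perturbation. -/

section Existence

variable {p r b r₀ : ℝ}

/-- The approximate solution at `ρ = r₀ e^{-t}`, frozen for `t < 0`. -/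
noncomputable def profile (p r b r₀ t : ℝ) : ℝ :=
  tailInv (nonlin p r) ((r₀ * Real.exp (-(max t 0))) ^ 2 / b)

lemma profile_arg_mem (hb : 0 < b) (hr₀ : 0 < r₀) (hy : r₀ ^ 2 / b < tailInt (nonlin p r) 1)
    (t : ℝ) : 0 < (r₀ * Real.exp (-(max t 0))) ^ 2 / b ∧
      (r₀ * Real.exp (-(max t 0))) ^ 2 / b ≤ tailInt (nonlin p r) 1 := by
  refine ⟨by positivity, le_trans ?_ hy.le⟩
  have h1 : Real.exp (-(max t 0)) ≤ 1 := Real.exp_le_one_iff.2 (by simp)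
  have h2 : r₀ * Real.exp (-(max t 0)) ≤ r₀ := by nlinarith
  gcongr

lemma one_le_profile (hp : 1 < p) (hrp : r < p) (hb : 0 < b) (hr₀ : 0 < r₀)
    (hy : r₀ ^ 2 / b < tailInt (nonlin p r) 1) (t : ℝ) : 1 ≤ profile p r b r₀ t :=
  (tailInv_spec hp hrp (profile_arg_mem hb hr₀ hy t).1 (profile_arg_mem hb hr₀ hy t).2).1

lemma continuous_profile (hp : 1 < p) (hrp : r < p) (hb : 0 < b) (hr₀ : 0 < r₀)
    (hy : r₀ ^ 2 / b < tailInt (nonlin p r) 1) : Continuous (profile p r b r₀) := by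
  refine continuous_iff_continuousAt.2 fun t => ?_
  have h1 := (hasDerivAt_tailInv hp hrp (profile_arg_mem hb hr₀ hy t).1
    (profile_arg_mem hb hr₀ hy t).2).continuousAt
  have h2 : ContinuousAt (fun t : ℝ => (r₀ * Real.exp (-(max t 0))) ^ 2 / b) t := by fun_prop
  exact ContinuousAt.comp (f := fun t : ℝ => (r₀ * Real.exp (-(max t 0))) ^ 2 / b) h1 h2

/-- Besides the rate μ, the bound displays the prefactor r₀^μ, the small parameter of the whole
construction. -/
lemma rpow_profile_le (hp : 1 < p) (hrp : r < p) (hb : 0 < b) (hr₀ : 0 < r₀)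
    (hy : r₀ ^ 2 / b < tailInt (nonlin p r) 1) {t : ℝ} (ht : 0 ≤ t) :
    profile p r b r₀ t ^ (r - p) ≤ (2 * (p - 1) / b) ^ ((p - r) / (p - 1)) *
      r₀ ^ (2 * (p - r) / (p - 1)) * Real.exp (-(2 * (p - r) / (p - 1) * t)) := by
  have h1 := rpow_tailInv_le hp hrp (profile_arg_mem hb hr₀ hy t).1
    (profile_arg_mem hb hr₀ hy t).2
  refine h1.trans_eq ?_
  have hp1 : 0 < p - 1 := by linarith
  rw [max_eq_left ht]
  have e1 : 2 * (p - 1) * ((r₀ * Real.exp (-t)) ^ 2 / b) =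
      2 * (p - 1) / b * (r₀ ^ 2 * Real.exp (-(2 * t))) := by
    have : Real.exp (-(2 * t)) = Real.exp (-t) ^ 2 := by
      rw [← Real.exp_nat_mul]; congr 1; push_cast; ring
    rw [this]
    ring
  rw [e1, Real.mul_rpow (by positivity) (by positivity), Real.mul_rpow (by positivity)
    (by positivity), ← Real.rpow_natCast, ← Real.rpow_mul hr₀.le, ← Real.exp_mul, ← mul_assoc]
  congr 2
  · congr 1; push_cast; ring
  · ring

lemma continuous_tailInt_comp {s : ℝ → ℝ} (hp : 1 < p) (hs : Continuous s) (h0 : ∀ t, 0 < s t) :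
    Continuous fun t => tailInt (nonlin p r) (s t) :=
  continuous_iff_continuousAt.2 fun t =>
    ContinuousAt.comp (hasDerivAt_tailInt hp (h0 t)).continuousAt hs.continuousAt

lemma continuous_nonlin_comp {s : ℝ → ℝ} (hs : Continuous s) (h0 : ∀ t, 0 < s t) :
    Continuous fun t => nonlin p r (s t) :=
  continuous_iff_continuousAt.2 fun t =>
    ContinuousAt.comp (hasDerivAt_nonlin (h0 t)).continuousAt hs.continuousAt

lemma continuous_tailRatio_comp {s : ℝ → ℝ} (hp : 1 < p) (hs : Continuous s)
    (h0 : ∀ t, 0 < s t) : Continuous fun t => tailRatio p r (s t) :=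
  ((continuous_tailInt_comp hp hs h0).mul (continuous_nonlin_comp hs h0)).div hs
    fun t => (h0 t).ne'

lemma continuous_holderDefect_comp {s : ℝ → ℝ} (hp : 1 < p) (hs : Continuous s)
    (h0 : ∀ t, 0 < s t) : Continuous fun t => holderDefect p r (s t) := by
  have h1 : Continuous fun t => deriv (nonlin p r) (s t) :=
    continuous_iff_continuousAt.2 fun t =>
      ContinuousAt.comp (hasDerivAt_deriv_nonlin (h0 t)).continuousAt hs.continuousAt
  exact (h1.mul (continuous_tailInt_comp hp hs h0)).sub continuous_const

lemma continuous_lowerShare_comp {s : ℝ → ℝ} (hs : Continuous s)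
    (h0 : ∀ t, 0 < s t) : Continuous fun t => lowerShare p r (s t) :=
  (hs.rpow_const fun t => Or.inl (h0 t).ne').div (continuous_nonlin_comp hs h0)
    fun t => (nonlin_pos (h0 t)).ne'

/-- Truncation to `[-m, m]`. -/
noncomputable def clamp (m x : ℝ) : ℝ := max (-m) (min m x)

lemma abs_clamp_le {m : ℝ} (hm : 0 ≤ m) (x : ℝ) : |clamp m x| ≤ m :=
  abs_le.2 ⟨le_max_left _ _, max_le (by linarith) (min_le_left _ _)⟩

lemma clamp_of_abs_le {m x : ℝ} (h : |x| ≤ m) : clamp m x = x := by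
  rw [clamp, min_eq_right (abs_le.1 h).2, max_eq_right (abs_le.1 h).1]

lemma abs_clamp_sub_le (m x y : ℝ) : |clamp m x - clamp m y| ≤ |x - y| := by
  refine (abs_max_sub_max_le_max _ _ _ _).trans ?_
  rw [sub_self, abs_zero]
  refine max_le (abs_nonneg _) ((abs_min_sub_min_le_max _ _ _ _).trans ?_)
  rw [sub_self, abs_zero]
  exact max_le (abs_nonneg _) le_rfl

/-- Truncation at m ≤ 1/2 keeps 1 + x ≥ 1/2, so the real powers are continuous for every value of
the unknown. -/
lemma continuous_perturbation_clamp {κ w h m : ℝ → ℝ} (hκ : Continuous κ) (hw : Continuous w)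
    (hh : Continuous h) (hm : Continuous m) (hm0 : ∀ t, 0 ≤ m t) (hm1 : ∀ t, m t ≤ 1 / 2) :
    Continuous fun z : ℝ × ℝ × ℝ =>
      perturbation b p r (κ z.1) (w z.1) (h z.1) (clamp (m z.1) z.2.1) z.2.2 := by
  have hc : Continuous fun z : ℝ × ℝ × ℝ => clamp (m z.1) z.2.1 := by
    unfold clamp
    fun_prop
  have hne : ∀ z : ℝ × ℝ × ℝ, 1 + clamp (m z.1) z.2.1 ≠ 0 := fun z => by
    have h1 := (abs_le.1 (abs_clamp_le (hm0 z.1) z.2.1)).1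
    have := hm1 z.1
    linarith
  have hpow : ∀ c : ℝ, Continuous fun z : ℝ × ℝ × ℝ => (1 + clamp (m z.1) z.2.1) ^ c := fun c =>
    (continuous_const.add hc).rpow_const fun z => Or.inl (hne z)
  have h1 := hpow p
  have h2 := hpow r
  unfold perturbation powRemainder
  fun_prop

/-- Existence of small decaying solutions of the equation for the relative perturbation. -/
theorem exists_relative_perturbation {a j l : ℝ} {k k' : ℝ → ℝ} {C : ℝ} (hp : 1 < p)
    (hr : 0 < r) (hrp : r < p) (hb : 0 < b) (ha : 0 < a) (hj : 0 ≤ j) (hj1 : j ≤ 1) (hl : 0 < l)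
    (hC : 0 < C) (hk : IsFundamentalSolution a b k k')
    (hkK : ∀ t, 0 ≤ t → |k t| ≤ C * decayKernel j l t ∧ |k' t| ≤ C * decayKernel j l t) :
    ∃ r₀ ε c M ν B : ℝ, 0 < r₀ ∧ r₀ ≤ 1 ∧ 0 < ε ∧ 0 < c ∧ 0 < ν ∧ 0 ≤ B ∧
      r₀ ^ 2 / b < tailInt (nonlin p r) 1 ∧
      (∀ t, 0 ≤ t → |holderDefect p r (profile p r b r₀ t)| ≤
        B * Real.exp (-(2 * (p - r) / (p - 1) * t))) ∧
      ∀ α β : ℝ, 0 < α → 0 < β → α + β < ε → ∃ θ η ζ : ℝ → ℝ,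
        (∀ t, HasDerivAt θ (η t) t) ∧ (∀ t, HasDerivAt η (ζ t) t) ∧ Continuous ζ ∧
        θ 0 = α ∧ η 0 = β ∧ ∀ t, 0 ≤ t →
          ζ t + a * η t + b * θ t = perturbation b p r (tailRatio p r (profile p r b r₀ t))
            (lowerShare p r (profile p r b r₀ t)) (holderDefect p r (profile p r b r₀ t))
            (θ t) (η t) ∧
          |θ t| ≤ 1 / 2 ∧ |θ t| ≤ B * Real.exp (-(ν * t)) ∧
          |θ t| + |η t| ≤
            M * decayWeight j l c (fun t => |holderDefect p r (profile p r b r₀ t)|) t := by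
  have hp1 : 0 < p - 1 := by linarith
  set μ := 2 * (p - r) / (p - 1) with hμ
  have hμ0 : 0 < μ := div_pos (by linarith) hp1
  -- Strictly below both the kernel rate and the forcing rate, so that one exponential dominates
  -- both A and e.
  set ν₀ := min l μ / 2 with hν₀
  have hmin : 0 < min l μ := lt_min hl hμ0
  have hν₀0 : 0 < ν₀ := by positivity
  have hν₀l : ν₀ < l := by linarith [min_le_left l μ]
  have hν₀μ : ν₀ < μ := by linarith [min_le_right l μ]
  set Ce := (2 * (p - 1) / b) ^ ((p - r) / (p - 1)) with hCe
  have hCe0 : 0 < Ce := by positivity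
  set ch := p / (p - 1) with hch
  have hch0 : 0 < ch := by positivity
  obtain ⟨Cp, hCp, hpert⟩ := exists_perturbation_lipschitz hb hp hrp hch0.le
  -- With this choice M/4 · A = C Cp (δK + K*H): the second summand is exactly the source
  -- contribution, and the first is left for the initial data.
  set M := 4 * (C * Cp) with hM
  have hM0 : 0 < M := by positivity
  set CA := (1 + 1 / (l - ν₀)) + ch * Ce * ((1 + 2 / (l - ν₀)) * (2 / (l - ν₀))) with hCA
  have hlν : 0 < l - ν₀ := by linarith
  have hCA0 : 0 < CA := by positivity
  -- The last factor trades the loss 1 + t for half of the rate ν₀.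
  set Λ₀ := Cp * (Ce + M * CA) * (1 + 1 / (ν₀ / 2)) with hΛ₀
  have hΛ₀0 : 0 < Λ₀ := by positivity
  have hF1 := tailInt_pos (r := r) hp hrp one_pos
  -- No constant so far depends on r₀. The last two conditions make the a priori bound MA at most
  -- 1/2 and the Lipschitz part a contraction with constant 1/2.
  have hsmall : ∀ᶠ ρ in 𝓝[>] (0 : ℝ), 0 < ρ ∧ ρ ≤ 1 ∧ ρ ^ 2 / b < tailInt (nonlin p r) 1 ∧
      M * CA * ρ ^ μ < 1 / 2 ∧ C * (Λ₀ * ρ ^ μ / (ν₀ / 2)) < 1 / 2 := by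
    have hpow : Tendsto (fun ρ : ℝ => ρ ^ μ) (𝓝[>] 0) (𝓝 0) := by
      have := (Real.continuousAt_rpow_const 0 μ (Or.inr hμ0.le)).tendsto
      rw [Real.zero_rpow hμ0.ne'] at this
      exact this.mono_left nhdsWithin_le_nhds
    have h1 : Tendsto (fun ρ : ℝ => ρ ^ 2 / b) (𝓝[>] 0) (𝓝 0) := by
      have : Tendsto (fun ρ : ℝ => ρ ^ 2 / b) (𝓝 0) (𝓝 ((0 : ℝ) ^ 2 / b)) :=
        Continuous.tendsto (by fun_prop) 0
      simp only [ne_eq, OfNat.ofNat_ne_zero, not_false_eq_true, zero_pow, zero_div] at this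
      exact this.mono_left nhdsWithin_le_nhds
    have h2 : Tendsto (fun ρ : ℝ => M * CA * ρ ^ μ) (𝓝[>] 0) (𝓝 0) := by
      simpa using hpow.const_mul (M * CA)
    have h3 : Tendsto (fun ρ : ℝ => C * (Λ₀ * ρ ^ μ / (ν₀ / 2))) (𝓝[>] 0) (𝓝 0) := by
      simpa using ((hpow.const_mul Λ₀).div_const (ν₀ / 2)).const_mul C
    filter_upwards [self_mem_nhdsWithin,
      mem_nhdsWithin_of_mem_nhds (gt_mem_nhds (zero_lt_one (α := ℝ))),
      h1.eventually (gt_mem_nhds hF1), h2.eventually (gt_mem_nhds one_half_pos),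
      h3.eventually (gt_mem_nhds one_half_pos)] with ρ a1 a2 a3 a4 a5
    exact ⟨a1, le_of_lt a2, a3, a4, a5⟩
  obtain ⟨r₀, hr₀, hr₀1, hy, hs1, hs2⟩ := hsmall.exists
  set δ := r₀ ^ μ with hδ
  have hδ0 : 0 < δ := by positivity
  have hδ1 : δ ≤ 1 := Real.rpow_le_one hr₀.le hr₀1 hμ0.le
  set s := profile p r b r₀ with hs
  have hs1' : ∀ t, 1 ≤ s t := one_le_profile hp hrp hb hr₀ hy
  have hs0 : ∀ t, 0 < s t := fun t => zero_lt_one.trans_le (hs1' t)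
  have hsc : Continuous s := continuous_profile hp hrp hb hr₀ hy
  set e : ℝ → ℝ := fun t => s t ^ (r - p) with he
  have hec : Continuous e := hsc.rpow_const fun t => Or.inl (hs0 t).ne'
  have he0 : ∀ t, 0 < e t := fun t => Real.rpow_pos_of_pos (hs0 t) _
  have he1 : ∀ t, e t ≤ 1 := fun t =>
    Real.rpow_le_one_of_one_le_of_nonpos (hs1' t) (by linarith)
  have heδ : ∀ t, 0 ≤ t → e t ≤ Ce * δ * Real.exp (-(μ * t)) := fun t ht =>
    rpow_profile_le hp hrp hb hr₀ hy ht
  set H : ℝ → ℝ := fun t => |holderDefect p r (s t)| with hH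
  have hhc := continuous_holderDefect_comp (r := r) hp hsc hs0
  have hHc : Continuous H := hhc.abs
  have hH0 : ∀ t, 0 ≤ t → 0 ≤ H t := fun t _ => abs_nonneg _
  have hHe : ∀ t, H t ≤ ch * e t := fun t => abs_holderDefect_le hp hr hrp (hs0 t)
  have hHδ : ∀ t, 0 ≤ t → H t ≤ ch * Ce * δ * Real.exp (-(μ * t)) := fun t ht => by
    refine (hHe t).trans ?_
    have := mul_le_mul_of_nonneg_left (heδ t ht) hch0.le
    linarith
  have hexp : ∀ t : ℝ, 0 ≤ t → Real.exp (-(μ * t)) ≤ Real.exp (-(ν₀ * t)) := fun t ht =>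
    Real.exp_le_exp.2 (neg_le_neg (mul_le_mul_of_nonneg_right hν₀μ.le ht))
  set A₀ := decayWeight j l δ H with hA₀
  have hA₀c : Continuous A₀ := continuous_decayWeight hHc
  have hA₀0 : ∀ t, 0 ≤ t → 0 < A₀ t := fun t ht => decayWeight_pos hj hδ0 hH0 ht
  have hA₀δ : ∀ t, 0 ≤ t → A₀ t ≤ CA * δ * Real.exp (-(ν₀ * t)) := fun t ht => by
    have h1 := mul_le_mul_of_nonneg_left (decayKernel_le_exp hj1 hν₀l ht) hδ0.le
    have h2 : decayConv j l H t ≤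
        decayConv j l (fun t => ch * Ce * δ * Real.exp (-(ν₀ * t))) t :=
      decayConv_mono hj hHc (by fun_prop) (fun t ht => (hHδ t ht).trans
        (mul_le_mul_of_nonneg_left (hexp t ht) (by positivity))) ht
    rw [decayConv_const_mul] at h2
    have h3 := mul_le_mul_of_nonneg_left (decayConv_exp_le_of_lt hj1 hν₀l ht)
      (show 0 ≤ ch * Ce * δ by positivity)
    rw [hA₀, decayWeight, hCA]
    linarith
  have hA₀half : ∀ t, 0 ≤ t → M * A₀ t ≤ 1 / 2 := fun t ht => by
    have h1 : Real.exp (-(ν₀ * t)) ≤ 1 := Real.exp_le_one_iff.2 (by nlinarith)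
    have h2 := mul_le_mul_of_nonneg_left (hA₀δ t ht) hM0.le
    have h3 := mul_le_mul_of_nonneg_left h1 (show 0 ≤ M * (CA * δ) by positivity)
    linarith
  set A : ℝ → ℝ := fun t => A₀ (max t 0) with hA
  have hAc : Continuous A := hA₀c.comp (by fun_prop)
  have hA0 : ∀ t, 0 < A t := fun t => hA₀0 _ (le_max_right _ _)
  have hAA : ∀ t, 0 ≤ t → A t = A₀ t := fun t ht => by simp only [hA, max_eq_left ht]
  -- The truncation level equals the bound that the fixed point will satisfy, so the truncation is
  -- inactive on the solution.
  set m : ℝ → ℝ := fun t => M * A t with hm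
  have hm0 : ∀ t, 0 ≤ m t := fun t => (mul_pos hM0 (hA0 t)).le
  have hm1 : ∀ t, m t ≤ 1 / 2 := fun t => hA₀half _ (le_max_right _ _)
  have hmc : Continuous m := hAc.const_mul M
  set g : ℝ → ℝ → ℝ → ℝ := fun t x y => perturbation b p r (tailRatio p r (s t))
    (lowerShare p r (s t)) (holderDefect p r (s t)) (clamp (m t) x) y with hg
  have hgc : Continuous fun z : ℝ × ℝ × ℝ => g z.1 z.2.1 z.2.2 :=
    continuous_perturbation_clamp (continuous_tailRatio_comp hp hsc hs0)
      (continuous_lowerShare_comp hsc hs0) hhc hmc hm0 hm1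
  have hpt := fun t => hpert (tailRatio p r (s t)) (lowerShare p r (s t))
    (holderDefect p r (s t)) (e t) (m t) (tailRatio_bounds hp hrp (hs0 t)).1
    (tailRatio_bounds hp hrp (hs0 t)).2 (he1 t) (lowerShare_bounds (hs0 t)).1
    (lowerShare_bounds (hs0 t)).2.1 (lowerShare_bounds (hs0 t)).2.2 (hHe t)
  set L : ℝ → ℝ := fun t => Cp * (e t + m t) with hL
  have hLc : Continuous L := (hec.add hmc).const_mul Cp
  have hL0 : ∀ t, 0 ≤ t → 0 ≤ L t := fun t _ =>
    mul_nonneg hCp.le (add_nonneg (he0 t).le (hm0 t))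
  have hgL : ∀ t, 0 ≤ t → ∀ x y x' y', |g t x y - g t x' y'| ≤ L t * max |x - x'| |y - y'| := by
    intro t ht x y x' y'
    refine ((hpt t).2 (hm1 t) _ y _ y' (abs_clamp_le (hm0 t) x)
      (abs_clamp_le (hm0 t) x')).trans ?_
    exact mul_le_mul_of_nonneg_left (max_le_max (abs_clamp_sub_le _ _ _) le_rfl) (hL0 t ht)
  have hgH : ∀ t, 0 ≤ t → |g t 0 0| ≤ Cp * H t := fun t _ => by
    have : clamp (m t) 0 = 0 := clamp_of_abs_le (by rw [abs_zero]; exact hm0 t)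
    simp only [hg, this]
    exact (hpt t).1
  have hCH : ∀ t, 0 ≤ t → C * ∫ σ in (0 : ℝ)..t, decayKernel j l (t - σ) * (Cp * H σ) ≤
      M / 4 * A t := by
    intro t ht
    have h1 := decayConv_const_mul (j := j) (l := l) (H := H) Cp t
    rw [decayConv] at h1
    rw [h1, hAA t ht, hM, hA₀, decayWeight]
    have h2 : 0 ≤ C * Cp * (δ * decayKernel j l t) :=
      mul_nonneg (by positivity) (mul_nonneg hδ0.le (decayKernel_pos hj ht).le)
    linarith
  have hLΛ : ∀ t, 0 ≤ t → (1 + t) * L t ≤ Λ₀ * δ * Real.exp (-(ν₀ / 2 * t)) := by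
    intro t ht
    have h1 : L t ≤ Cp * (Ce + M * CA) * δ * Real.exp (-(ν₀ * t)) := by
      have a1 := (heδ t ht).trans (mul_le_mul_of_nonneg_left (hexp t ht) (by positivity))
      have a2 := mul_le_mul_of_nonneg_left (hA₀δ t ht) hM0.le
      have a3 := mul_le_mul_of_nonneg_left (add_le_add a1 a2) hCp.le
      simp only [hL, hm, hAA t ht]
      linarith
    have h2 := one_add_le_exp_mul (half_pos hν₀0) ht
    have h3 := mul_le_mul h2 h1 (hL0 t ht) (by positivity)
    refine h3.trans_eq ?_
    have h4 : Real.exp (-(ν₀ / 2 * t)) = Real.exp (ν₀ / 2 * t) * Real.exp (-(ν₀ * t)) := by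
      rw [← Real.exp_add]; congr 1; ring
    rw [h4, hΛ₀]
    ring
  have hCL : ∀ t, 0 ≤ t → C * ∫ σ in (0 : ℝ)..t, decayKernel j l (t - σ) * (L σ * A σ) ≤
      1 / 2 * A t := by
    intro t ht
    have e1 : ∫ σ in (0 : ℝ)..t, decayKernel j l (t - σ) * (L σ * A σ) =
        ∫ σ in (0 : ℝ)..t, decayKernel j l (t - σ) * (L σ * A₀ σ) := by
      refine intervalIntegral.integral_congr fun σ hσ => ?_
      rw [uIcc_of_le ht] at hσ
      simp only [hAA σ hσ.1]
    have h1 := integral_decayKernel_mul_decayWeight_le hj hj1 hδ0.le hHc hH0 hLc hL0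
      (half_pos hν₀0) (mul_pos hΛ₀0 hδ0).le hLΛ ht (hA₀0 t ht).le
    rw [e1, hAA t ht]
    have h2 := mul_le_mul_of_nonneg_left h1 hC.le
    have h3 := mul_le_mul_of_nonneg_right hs2.le (hA₀0 t ht).le
    linarith
  -- This ε lets the homogeneous solution, at most (α+β)(1+a+b)CK, fit into C Cp δK.
  refine ⟨r₀, δ * Cp / (1 + a + b), δ, 2 * M, ν₀, max (ch * Ce * δ) (M * (CA * δ)), hr₀, hr₀1,
    by positivity, hδ0, hν₀0, by positivity, hy, fun t ht => (hHδ t ht).trans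
      (mul_le_mul_of_nonneg_right (le_max_left _ _) (Real.exp_pos _).le), ?_⟩
  intro α β hα hβ hαβ
  rw [lt_div_iff₀ (by positivity)] at hαβ
  have hhom : ∀ t, 0 ≤ t → (α + β) * (1 + a + b) * (C * decayKernel j l t) ≤ M / 4 * A t := by
    intro t ht
    have h1 := (decayKernel_pos (l := l) hj ht).le
    have h2 := decayConv_nonneg (l := l) hj hH0 ht
    have h3 := mul_le_mul_of_nonneg_right hαβ.le (mul_nonneg hC.le h1)
    have h4 : 0 ≤ C * Cp * decayConv j l H t := by positivity
    rw [hAA t ht, hM, hA₀, decayWeight]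
    linarith
  obtain ⟨θ, η, ζ, d1, d2, hζ, heq, hθ0, hη0, hbd⟩ := exists_solution_of_weighted_contraction
    (α := α) (β := β) (M := M) hk continuous_decayKernel (fun t ht => (hkK t ht).1)
    (fun t ht => (hkK t ht).2) hAc hA0 hLc (hHc.const_mul Cp) hgc hgL hL0 hgH
    (fun t ht => by
      refine le_trans ?_ (hhom t ht)
      obtain ⟨h1, h2⟩ := hkK t ht
      have h0 := (abs_nonneg _).trans h1
      set Q := C * decayKernel j l t
      have a1 : |α * (k' t + a * k t)| ≤ α * (Q + a * Q) := by
        rw [abs_mul, abs_of_pos hα]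
        refine mul_le_mul_of_nonneg_left ((abs_add_le _ _).trans (add_le_add h2 ?_)) hα.le
        rw [abs_mul, abs_of_pos ha]
        exact mul_le_mul_of_nonneg_left h1 ha.le
      have a2 : |β * k t| ≤ β * Q := by
        rw [abs_mul, abs_of_pos hβ]
        exact mul_le_mul_of_nonneg_left h1 hβ.le
      refine (abs_add_le _ _).trans ((add_le_add a1 a2).trans ?_)
      have b1 : 0 ≤ α * b * Q := by positivity
      have b2 : 0 ≤ β * (a + b) * Q := by positivity
      linarith)
    (fun t ht => by
      refine le_trans ?_ (hhom t ht)
      obtain ⟨h1, h2⟩ := hkK t ht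
      have h0 := (abs_nonneg _).trans h1
      set Q := C * decayKernel j l t
      have a1 : |α * (-b * k t)| ≤ α * (b * Q) := by
        rw [abs_mul, abs_of_pos hα, abs_mul, abs_neg, abs_of_pos hb]
        exact mul_le_mul_of_nonneg_left (mul_le_mul_of_nonneg_left h1 hb.le) hα.le
      have a2 : |β * k' t| ≤ β * Q := by
        rw [abs_mul, abs_of_pos hβ]
        exact mul_le_mul_of_nonneg_left h2 hβ.le
      refine (abs_add_le _ _).trans ((add_le_add a1 a2).trans ?_)
      have b1 : 0 ≤ α * (1 + a) * Q := by positivity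
      have b2 : 0 ≤ β * (a + b) * Q := by positivity
      linarith)
    hCH hCL
  refine ⟨θ, η, ζ, d1, d2, hζ, hθ0, hη0, fun t ht => ⟨?_, ?_, ?_, ?_⟩⟩
  · rw [heq t ht]
    simp only [hg]
    rw [clamp_of_abs_le (hbd t ht).1]
  · exact (hbd t ht).1.trans (hm1 t)
  · refine (hbd t ht).1.trans ?_
    rw [hAA t ht]
    refine (mul_le_mul_of_nonneg_left (hA₀δ t ht) hM0.le).trans ?_
    rw [← mul_assoc]
    exact mul_le_mul_of_nonneg_right (le_max_right _ _) (Real.exp_pos _).le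
  · have h1 := (hbd t ht).1
    have h2 := (hbd t ht).2
    rw [hAA t ht] at h1 h2
    linarith

end Existence

/-! From the perturbation in logarithmic time to the singular solution. -/

section Assembly

variable {N : ℕ} {p r b r₀ : ℝ} {θ η ζ : ℝ → ℝ}

/-- The equation for the relative perturbation, rewritten as the radial equation in `y = ρ ^ 2`. -/
lemma radial_equation_of_perturbation {v y x x' x'' : ℝ} (hp : 1 < p)
    (hb : b = 2 * (N : ℝ) - 4 * (p / (p - 1))) (hb0 : 0 < b)
    (hv : 0 < v) (hy : 0 < y) (hF : tailInt (nonlin p r) v = y / b) (hx : |x| ≤ 1 / 2)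
    (h : x'' + coeffA N p * x' + b * x = perturbation b p r (tailRatio p r v) (lowerShare p r v)
      (holderDefect p r v) x x') :
    -(4 * y * (deriv (nonlin p r) v * nonlin p r v / b ^ 2 * (1 + x) +
        nonlin p r v * x' / (b * y) + v * x'' / (4 * y ^ 2) + v * x' / (2 * y ^ 2)) +
      2 * N * (-(nonlin p r v / b) * (1 + x) - v * x' / (2 * y))) =
      nonlin p r (v * (1 + x)) := by
  have hp1 : p - 1 ≠ 0 := by linarith
  have h1x : 0 < 1 + x := by linarith [(abs_le.1 hx).1]
  have hf0 := nonlin_pos (p := p) (r := r) hv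
  have hw : lowerShare p r v * nonlin p r v = v ^ r := by
    rw [lowerShare, div_mul_cancel₀ _ hf0.ne']
  have hw' : (1 - lowerShare p r v) * nonlin p r v = v ^ p := by
    rw [sub_mul, hw, nonlin]; ring
  have hR : nonlin p r (v * (1 + x)) = nonlin p r v *
      ((1 - lowerShare p r v) * (1 + x) ^ p + lowerShare p r v * (1 + x) ^ r) := by
    rw [nonlin, Real.mul_rpow hv.le h1x.le, Real.mul_rpow hv.le h1x.le, ← hw, ← hw']
    ring
  have hκ : nonlin p r v = tailRatio p r v * v * b / y := by
    rw [tailRatio, hF]; field_simp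
  have hh : deriv (nonlin p r) v = (holderDefect p r v + p / (p - 1)) * b / y := by
    rw [holderDefect, hF]; field_simp; ring
  rw [hR, hκ, hh]
  unfold perturbation powRemainder at h
  set κ := tailRatio p r v
  set w := lowerShare p r v
  set d := holderDefect p r v
  set X := (1 + x) ^ p
  set Z := (1 + x) ^ r
  have hq : p / (p - 1) = 1 + 1 / (p - 1) := by field_simp; ring
  have ha : coeffA N p = 4 * (1 / (p - 1)) - N + 2 := by rw [coeffA]; ring
  rw [hq] at hb ⊢
  rw [ha] at h
  set c := 1 / (p - 1)
  have e1 : -(4 * y * ((d + (1 + c)) * b / y * (κ * v * b / y) / b ^ 2 * (1 + x) +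
        κ * v * b / y * x' / (b * y) + v * x'' / (4 * y ^ 2) + v * x' / (2 * y ^ 2)) +
      2 * N * (-(κ * v * b / y / b) * (1 + x) - v * x' / (2 * y))) =
      -(v / y) * (4 * κ * (d + (1 + c)) * (1 + x) + 4 * κ * x' + x'' + 2 * x' -
        2 * N * κ * (1 + x) - N * x') := by
    field_simp
    ring
  rw [e1]
  linear_combination -(v / y) * h - (v / y) * (1 + x) * κ * hb

/-- Bootstrap through T' = -f(T): each pass gains one derivative. -/
lemma contDiffOn_tailInv (hp : 1 < p) (hrp : r < p) :
    ContDiffOn ℝ 2 (tailInv (nonlin p r)) (Ioo 0 (tailInt (nonlin p r) 1)) := by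
  set T := tailInv (nonlin p r)
  set I := Ioo 0 (tailInt (nonlin p r) 1)
  have hd : ∀ y ∈ I, HasDerivAt T (-nonlin p r (T y)) y := fun y hy =>
    hasDerivAt_tailInv hp hrp hy.1 hy.2.le
  have hmaps : MapsTo T I (Ioi 0) := fun y hy =>
    zero_lt_one.trans_le (tailInv_spec hp hrp hy.1 hy.2.le).1
  have step : ∀ n : ℕ, n ≤ 1 → ContDiffOn ℝ n T I → ContDiffOn ℝ (n + 1) T I := by
    intro n hn h
    rw [contDiffOn_succ_iff_deriv_of_isOpen isOpen_Ioo]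
    refine ⟨fun y hy => (hd y hy).differentiableAt.differentiableWithinAt, by simp, ?_⟩
    have h1 : ContDiffOn ℝ n (fun y => -nonlin p r (T y)) I := by
      refine ContDiffOn.neg (ContDiffOn.comp (contDiffOn_nonlin.of_le ?_) h hmaps)
      exact_mod_cast hn.trans one_le_two
    exact h1.congr fun y hy => (hd y hy).deriv
  have h0 : ContDiffOn ℝ (0 : ℕ) T I := by
    rw [Nat.cast_zero, contDiffOn_zero]
    exact fun y hy => (hd y hy).continuousAt.continuousWithinAt
  have h2 := step 1 le_rfl (by simpa using step 0 zero_le_one h0)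
  have e : ((1 : ℕ) : WithTop ℕ∞) + 1 = 2 := by norm_num
  rwa [e] at h2

lemma contDiff_two_of_hasDerivAt (h1 : ∀ t, HasDerivAt θ (η t) t)
    (h2 : ∀ t, HasDerivAt η (ζ t) t) (hζ : Continuous ζ) : ContDiff ℝ 2 θ := by
  have e1 : deriv θ = η := funext fun t => (h1 t).deriv
  have e2 : deriv η = ζ := funext fun t => (h2 t).deriv
  have h3 : ContDiff ℝ 1 η := contDiff_one_iff_deriv.2
    ⟨fun t => (h2 t).differentiableAt, by rwa [e2]⟩
  rw [show (2 : WithTop ℕ∞) = 1 + 1 by norm_num, contDiff_succ_iff_deriv]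
  exact ⟨fun t => (h1 t).differentiableAt, by simp, by rwa [e1]⟩

/-- The solution as a function of `y = ρ ^ 2`. -/
noncomputable def radialSolution (p r b r₀ : ℝ) (θ : ℝ → ℝ) (y : ℝ) : ℝ :=
  tailInv (nonlin p r) (y / b) * (1 + θ (Real.log r₀ - Real.log y / 2))

lemma profile_log {ρ : ℝ} (hr₀ : 0 < r₀) (hρ : 0 < ρ) (hρr : ρ ≤ r₀) :
    profile p r b r₀ (Real.log (r₀ / ρ)) = tailInv (nonlin p r) (ρ ^ 2 / b) := by
  have h1 : 0 ≤ Real.log (r₀ / ρ) := Real.log_nonneg ((one_le_div hρ).2 hρr)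
  have h2 : r₀ * Real.exp (-Real.log (r₀ / ρ)) = ρ := by
    rw [Real.exp_neg, Real.exp_log (div_pos hr₀ hρ)]
    field_simp
  rw [profile, max_eq_left h1, h2]

lemma hasDerivAt_log_time {y : ℝ} (hy : 0 < y) :
    HasDerivAt (fun y => Real.log r₀ - Real.log y / 2) (-(1 / (2 * y))) y := by
  refine (((Real.hasDerivAt_log hy.ne').div_const 2).const_sub (Real.log r₀)).congr_deriv ?_
  field_simp

/-- In the variable y = ρ² both factors have elementary derivatives, and the equation becomes
pointwise the one for θ at t = log(r₀/ρ). Positivity and blow-up follow from 1 + θ ≥ 1/2. -/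
theorem isSingularSolution_radialSolution (hp : 1 < p) (hrp : r < p)
    (hb : b = 2 * (N : ℝ) - 4 * (p / (p - 1))) (hb0 : 0 < b) (hr₀ : 0 < r₀)
    (hy₀ : r₀ ^ 2 / b < tailInt (nonlin p r) 1)
    (h1 : ∀ t, HasDerivAt θ (η t) t) (h2 : ∀ t, HasDerivAt η (ζ t) t) (hζ : Continuous ζ)
    (heq : ∀ t, 0 ≤ t → ζ t + coeffA N p * η t + b * θ t =
      perturbation b p r (tailRatio p r (profile p r b r₀ t))
        (lowerShare p r (profile p r b r₀ t)) (holderDefect p r (profile p r b r₀ t))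
        (θ t) (η t))
    (hθ : ∀ t, 0 ≤ t → |θ t| ≤ 1 / 2) :
    IsSingularSolution N (nonlin p r) r₀ (fun x => radialSolution p r b r₀ θ (‖x‖ ^ 2)) := by
  set T := tailInv (nonlin p r) with hT
  set f := nonlin p r with hf
  have hball : ∀ x ∈ Metric.ball (0 : EuclideanSpace ℝ (Fin N)) r₀ \ {0},
      0 < ‖x‖ ∧ ‖x‖ < r₀ := fun x hx =>
    ⟨norm_pos_iff.2 fun h => hx.2 (by simp [h]), by simpa using hx.1⟩
  have hI : ∀ y ∈ Ioo 0 (r₀ ^ 2), y / b ∈ Ioo 0 (tailInt f 1) := fun y hy =>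
    ⟨div_pos hy.1 hb0, (div_lt_div_of_pos_right hy.2 hb0).trans hy₀⟩
  have hTpos : ∀ y ∈ Ioo 0 (r₀ ^ 2), 0 < T (y / b) := fun y hy =>
    zero_lt_one.trans_le (tailInv_spec hp hrp (hI y hy).1 (hI y hy).2.le).1
  have hτ : ∀ y ∈ Ioo 0 (r₀ ^ 2), 0 ≤ Real.log r₀ - Real.log y / 2 := fun y hy => by
    have := Real.log_lt_log hy.1 hy.2
    rw [Real.log_pow] at this
    push_cast at this
    linarith
  have hsq : ∀ x ∈ Metric.ball (0 : EuclideanSpace ℝ (Fin N)) r₀ \ {0},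
      ‖x‖ ^ 2 ∈ Ioo 0 (r₀ ^ 2) := fun x hx =>
    ⟨by have := (hball x hx).1; positivity, by
      have := hball x hx
      exact pow_lt_pow_left₀ this.2 this.1.le two_ne_zero⟩
  have hhalf : ∀ y ∈ Ioo 0 (r₀ ^ 2), 1 / 2 ≤ 1 + θ (Real.log r₀ - Real.log y / 2) := fun y hy => by
    linarith [(abs_le.1 (hθ _ (hτ y hy))).1]
  have hC : ContDiffOn ℝ 2 (radialSolution p r b r₀ θ) (Ioo 0 (r₀ ^ 2)) := by
    have c1 : ContDiffOn ℝ 2 (fun y => T (y / b)) (Ioo 0 (r₀ ^ 2)) :=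
      (contDiffOn_tailInv hp hrp).comp (contDiff_id.div_const b).contDiffOn hI
    have c2 : ContDiffOn ℝ 2 (fun y => Real.log r₀ - Real.log y / 2) (Ioo 0 (r₀ ^ 2)) :=
      contDiffOn_const.sub ((contDiffOn_id.log fun y hy => hy.1.ne').div_const 2)
    exact c1.mul (contDiffOn_const.add ((contDiff_two_of_hasDerivAt h1 h2 hζ).comp_contDiffOn c2))
  refine ⟨?_, ?_, ?_, ?_⟩
  · exact hC.comp (contDiff_norm_sq ℝ).contDiffOn hsq
  · intro x hx
    exact mul_pos (hTpos _ (hsq x hx)) (by linarith [hhalf _ (hsq x hx)])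
  · intro x hx
    have dT : ∀ y ∈ Ioo 0 (r₀ ^ 2), HasDerivAt (fun y => T (y / b)) (-(f (T (y / b)) / b)) y := by
      intro y hy
      refine ((hasDerivAt_tailInv hp hrp (hI y hy).1 (hI y hy).2.le).comp y
        ((hasDerivAt_id y).div_const b)).congr_deriv ?_
      rw [← hf, ← hT]
      ring
    have dθ : ∀ y ∈ Ioo 0 (r₀ ^ 2), HasDerivAt
        (fun y => θ (Real.log r₀ - Real.log y / 2))
        (η (Real.log r₀ - Real.log y / 2) * -(1 / (2 * y))) y := fun y hy =>
      (h1 _).comp y (hasDerivAt_log_time hy.1)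
    have dη : ∀ y ∈ Ioo 0 (r₀ ^ 2), HasDerivAt
        (fun y => η (Real.log r₀ - Real.log y / 2))
        (ζ (Real.log r₀ - Real.log y / 2) * -(1 / (2 * y))) y := fun y hy =>
      (h2 _).comp y (hasDerivAt_log_time hy.1)
    set W' : ℝ → ℝ := fun y => -(f (T (y / b)) / b) * (1 + θ (Real.log r₀ - Real.log y / 2)) -
      T (y / b) * η (Real.log r₀ - Real.log y / 2) / (2 * y) with hW'
    have hd1 : ∀ y ∈ Ioo 0 (r₀ ^ 2), HasDerivAt (radialSolution p r b r₀ θ) (W' y) y := by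
      intro y hy
      refine ((dT y hy).mul ((dθ y hy).const_add 1)).congr_deriv ?_
      simp only [hW']
      ring
    have hy := hsq x hx
    set y := ‖x‖ ^ 2 with hydef
    have hy0 : y ≠ 0 := hy.1.ne'
    have dfT := ((hasDerivAt_nonlin (p := p) (r := r) (hTpos y hy)).comp y (dT y hy))
    rw [← deriv_nonlin (hTpos y hy)] at dfT
    have hd2 := (((dfT.div_const b).neg.mul ((dθ y hy).const_add 1)).sub
      (((dT y hy).mul (dη y hy)).div ((hasDerivAt_id y).const_mul 2)
        (by simpa using hy0)))
    have hlap := laplacian_comp_norm_sq (N := N) (x := x)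
      (eventually_of_mem (isOpen_Ioo.mem_nhds hy) hd1) hd2
    have hkey := radial_equation_of_perturbation (N := N) (r := r) hp hb hb0 (hTpos y hy) hy.1
      (tailInv_spec hp hrp (hI y hy).1 (hI y hy).2.le).2 (hθ _ (hτ y hy)) (by
        have := heq _ (hτ y hy)
        have e : Real.log r₀ - Real.log y / 2 = Real.log (r₀ / ‖x‖) := by
          rw [hydef, Real.log_pow, Real.log_div hr₀.ne' (hball x hx).1.ne']
          push_cast
          ring
        have e2 : profile p r b r₀ (Real.log r₀ - Real.log y / 2) = T (y / b) := by
          rw [e, profile_log hr₀ (hball x hx).1 (hball x hx).2.le]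
        rwa [e2] at this)
    have e3 : f (radialSolution p r b r₀ θ y) =
      nonlin p r (T (y / b) * (1 + θ (Real.log r₀ - Real.log y / 2))) := rfl
    rw [e3, ← hkey, hlap, ← hydef]
    simp only [hW', Function.comp_apply, Pi.neg_apply, Pi.mul_apply, id]
    have hb0' := hb0.ne'
    rw [← hf]
    congr 1
    field_simp
    ring
  · have hlim : Tendsto (fun x : EuclideanSpace ℝ (Fin N) => ‖x‖ ^ 2 / b) (𝓝[≠] 0) (𝓝[>] 0) := by
      refine tendsto_nhdsWithin_iff.2 ⟨?_, ?_⟩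
      · have : Tendsto (fun x : EuclideanSpace ℝ (Fin N) => ‖x‖ ^ 2 / b) (𝓝 0)
            (𝓝 (‖(0 : EuclideanSpace ℝ (Fin N))‖ ^ 2 / b)) := Continuous.tendsto (by fun_prop) 0
        simp only [norm_zero, ne_eq, OfNat.ofNat_ne_zero, not_false_eq_true, zero_pow,
          zero_div] at this
        exact this.mono_left nhdsWithin_le_nhds
      · filter_upwards [self_mem_nhdsWithin] with x hx
        have : 0 < ‖x‖ := norm_pos_iff.2 hx
        exact mem_Ioi.2 (by positivity)
    have h3 := ((tendsto_tailInv hp hrp).comp hlim).atTop_div_const (two_pos (α := ℝ))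
    refine tendsto_atTop_mono' _ ?_ h3
    filter_upwards [self_mem_nhdsWithin, mem_nhdsWithin_of_mem_nhds (Metric.ball_mem_nhds _ hr₀)]
      with x hx1 hx2
    have hy := hsq x ⟨hx2, hx1⟩
    have := mul_le_mul_of_nonneg_left (hhalf _ hy) (hTpos _ hy).le
    rw [radialSolution]
    simp only [Function.comp_apply]
    linarith

/-! ### Back to the radius: regularity of θ and the kernel integral. -/

/-- The relative perturbation as a function of the radius. -/
noncomputable def radialPerturbation (r₀ : ℝ) (θ : ℝ → ℝ) (ρ : ℝ) : ℝ :=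
  if ρ ≤ 0 then 0 else θ (Real.log (r₀ / ρ))

lemma radialPerturbation_eventuallyEq {ρ : ℝ} (hr₀ : 0 < r₀) (hρ : 0 < ρ) :
    radialPerturbation r₀ θ =ᶠ[𝓝 ρ] fun ρ => θ (Real.log r₀ - Real.log ρ) := by
  filter_upwards [lt_mem_nhds hρ] with x hx
  rw [radialPerturbation, if_neg hx.not_ge, Real.log_div hr₀.ne' hx.ne']

lemma hasDerivAt_radialPerturbation (h1 : ∀ t, HasDerivAt θ (η t) t) {ρ : ℝ} (hr₀ : 0 < r₀)
    (hρ : 0 < ρ) :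
    HasDerivAt (radialPerturbation r₀ θ) (-(η (Real.log (r₀ / ρ)) / ρ)) ρ := by
  refine HasDerivAt.congr_of_eventuallyEq ?_ (radialPerturbation_eventuallyEq hr₀ hρ)
  refine ((h1 _).comp ρ ((Real.hasDerivAt_log hρ.ne').const_sub (Real.log r₀))).congr_deriv ?_
  rw [Real.log_div hr₀.ne' hρ.ne']
  ring

lemma contDiffOn_radialPerturbation (hθ : ContDiff ℝ 2 θ) (hr₀ : 0 < r₀) :
    ContDiffOn ℝ 2 (radialPerturbation r₀ θ) (Ioi 0) := by
  intro ρ hρ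
  refine ContDiffAt.contDiffWithinAt ?_
  refine ContDiffAt.congr_of_eventuallyEq ?_ (radialPerturbation_eventuallyEq hr₀ hρ)
  exact hθ.contDiffAt.comp ρ (contDiffAt_const.sub (Real.contDiffAt_log.2 (ne_of_gt hρ)))

/-- Exponential decay in t is the power (ρ/r₀)^ν, so the value 0 assigned at ρ = 0 is the limit. -/
lemma continuousOn_radialPerturbation (hθ : ContDiff ℝ 2 θ) (hr₀ : 0 < r₀) {B ν : ℝ}
    (hν : 0 < ν) (hB : ∀ t, 0 ≤ t → |θ t| ≤ B * Real.exp (-(ν * t))) :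
    ContinuousOn (radialPerturbation r₀ θ) (Icc 0 r₀) := by
  intro ρ hρ
  rcases hρ.1.eq_or_lt with h | h
  · subst h
    have h0 : radialPerturbation r₀ θ 0 = 0 := by rw [radialPerturbation, if_pos le_rfl]
    rw [ContinuousWithinAt, h0, tendsto_zero_iff_abs_tendsto_zero]
    have hlim : Tendsto (fun ρ : ℝ => B * (ρ / r₀) ^ ν) (𝓝[Icc 0 r₀] 0) (𝓝 0) := by
      have c : ContinuousAt (fun ρ : ℝ => B * (ρ / r₀) ^ ν) 0 :=
        continuousAt_const.mul ((continuousAt_id.div_const r₀).rpow_const (Or.inr hν.le))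
      have := c.tendsto
      simp only [zero_div, Real.zero_rpow hν.ne', mul_zero] at this
      exact this.mono_left nhdsWithin_le_nhds
    refine squeeze_zero' (Eventually.of_forall fun _ => abs_nonneg _) ?_ hlim
    filter_upwards [self_mem_nhdsWithin] with x hx
    rcases hx.1.eq_or_lt with h | h
    · subst h
      simp [h0, Real.zero_rpow hν.ne']
    · have := hB _ (Real.log_nonneg ((one_le_div h).2 hx.2))
      rw [← div_rpow_eq_exp h hr₀] at this
      simpa only [Function.comp_apply, radialPerturbation, if_neg h.not_ge] using this
  · exact ((contDiffOn_radialPerturbation hθ hr₀).continuousOn.continuousAt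
      (Ioi_mem_nhds h)).continuousWithinAt

/-- The kernel integral in logarithmic time. -/
lemma integral_kernelP_eq (hp : 1 < p) (hrp : r < p) (hb : b = 2 * (N : ℝ) - 4 * (p / (p - 1)))
    (hb0 : 0 < b) (hr₀ : 0 < r₀) (hy₀ : r₀ ^ 2 / b < tailInt (nonlin p r) 1) {ρ : ℝ} (hρ : 0 < ρ)
    (hρr : ρ ≤ r₀) :
    ∫ s in ρ..r₀, kernelP N p ρ s *
      |deriv (nonlin p r) (uTilde N (p / (p - 1)) (nonlin p r) s) *
        tailInt (nonlin p r) (uTilde N (p / (p - 1)) (nonlin p r) s) - p / (p - 1)| / s =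
    decayConv (kernelLogOrder N p) (kernelRate N p)
      (fun t => |holderDefect p r (profile p r b r₀ t)|) (Real.log (r₀ / ρ)) := by
  set H : ℝ → ℝ := fun t => |holderDefect p r (profile p r b r₀ t)| with hH
  set K := decayKernel (kernelLogOrder N p) (kernelRate N p) with hK
  have hKc : Continuous K := continuous_decayKernel
  have hHc : Continuous H := (continuous_holderDefect_comp hp (continuous_profile hp hrp hb0 hr₀ hy₀)
    fun t => zero_lt_one.trans_le (one_le_profile hp hrp hb0 hr₀ hy₀ t)).abs
  set G : ℝ → ℝ := fun s => K (Real.log (s / ρ)) * H (Real.log (r₀ / s)) / s with hG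
  have e1 : ∫ s in ρ..r₀, kernelP N p ρ s *
      |deriv (nonlin p r) (uTilde N (p / (p - 1)) (nonlin p r) s) *
        tailInt (nonlin p r) (uTilde N (p / (p - 1)) (nonlin p r) s) - p / (p - 1)| / s =
      ∫ s in ρ..r₀, G s := by
    refine intervalIntegral.integral_congr fun s hs => ?_
    rw [uIcc_of_le hρr] at hs
    have hs0 : 0 < s := hρ.trans_le hs.1
    simp only [hG, hH, hK]
    rw [profile_log hr₀ hs0 hs.2, kernelP_eq hρ hs0, uTilde, ← hb, holderDefect]
  set t := Real.log (r₀ / ρ) with ht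
  have ht0 : 0 ≤ t := Real.log_nonneg ((one_le_div hρ).2 hρr)
  have hexp : r₀ * Real.exp (-t) = ρ := by
    rw [ht, Real.exp_neg, Real.exp_log (div_pos hr₀ hρ)]
    field_simp
  -- The substitution s = r₀ e^(-σ) turns ds/s into -dσ; the sign cancels the reversal of the
  -- limits.
  have hsub := intervalIntegral.integral_comp_mul_deriv' (a := 0) (b := t)
    (f := fun σ => r₀ * Real.exp (-σ)) (f' := fun σ => -(r₀ * Real.exp (-σ))) (g := G)
    (fun σ _ => by
      refine (((hasDerivAt_id σ).neg.exp).const_mul r₀).congr_deriv ?_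
      simp)
    (by fun_prop)
    (by
      rintro _ ⟨σ, -, rfl⟩
      have hpos : 0 < r₀ * Real.exp (-σ) := by positivity
      refine ContinuousAt.continuousWithinAt ?_
      refine ContinuousAt.div (ContinuousAt.mul ?_ ?_) continuousAt_id hpos.ne'
      · exact hKc.continuousAt.comp
          ((continuousAt_id.div_const ρ).log (div_pos hpos hρ).ne')
      · exact hHc.continuousAt.comp
          ((continuousAt_const.div continuousAt_id hpos.ne').log (div_pos hr₀ hpos).ne'))
  simp only [neg_zero, Real.exp_zero, mul_one, hexp] at hsub
  rw [e1, intervalIntegral.integral_symm, ← hsub, decayConv, ← intervalIntegral.integral_neg]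
  refine intervalIntegral.integral_congr fun σ _ => ?_
  have hpos : 0 < r₀ * Real.exp (-σ) := by positivity
  have l1 : Real.log (r₀ * Real.exp (-σ) / ρ) = t - σ := by
    rw [ht, Real.log_div hpos.ne' hρ.ne', Real.log_mul hr₀.ne' (Real.exp_pos _).ne', Real.log_exp,
      Real.log_div hr₀.ne' hρ.ne']
    ring
  have l2 : Real.log (r₀ / (r₀ * Real.exp (-σ))) = σ := by
    rw [Real.log_div hr₀.ne' hpos.ne', Real.log_mul hr₀.ne' (Real.exp_pos _).ne', Real.log_exp]
    ring
  simp only [Function.comp_apply, hG, l1, l2]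
  field_simp
  rw [mul_comm]

/-- The defect is nonzero at some positive time. -/
lemma exists_holderDefect_profile_ne_zero (hp : 1 < p) (hr : 0 < r) (hrp : r < p) (hb0 : 0 < b)
    (hr₀ : 0 < r₀) (hy₀ : r₀ ^ 2 / b < tailInt (nonlin p r) 1) :
    ∃ t, 0 < t ∧ holderDefect p r (profile p r b r₀ t) ≠ 0 := by
  obtain ⟨hS1, hS2⟩ := tailInv_spec hp hrp (div_pos (pow_pos hr₀ 2) hb0) hy₀.le
  set S := tailInv (nonlin p r) (r₀ ^ 2 / b)
  obtain ⟨s, hs, hne⟩ := exists_holderDefect_ne_zero hp hr hrp S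
  have hS0 : 0 < S := zero_lt_one.trans_le hS1
  have hs0 : 0 < s := hS0.trans hs
  have hF := strictAntiOn_tailInt (r := r) hp (mem_Ioi.2 hS0) (mem_Ioi.2 hs0) hs
  rw [hS2] at hF
  have hF0 := tailInt_pos hp hrp hs0
  -- The radius at which the approximate solution takes the value s.
  set ρ := √(b * tailInt (nonlin p r) s) with hρ
  have hρ0 : 0 < ρ := Real.sqrt_pos.2 (mul_pos hb0 hF0)
  have hρ2 : ρ ^ 2 = b * tailInt (nonlin p r) s := Real.sq_sqrt (mul_pos hb0 hF0).le
  have hρr : ρ < r₀ := by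
    rw [lt_div_iff₀ hb0] at hF
    exact lt_of_pow_lt_pow_left₀ 2 hr₀.le (by linarith)
  refine ⟨Real.log (r₀ / ρ), Real.log_pos ((one_lt_div hρ0).2 hρr), ?_⟩
  rwa [profile_log hr₀ hρ0 hρr.le, hρ2, mul_div_cancel_left₀ _ hb0.ne', tailInv_tailInt hp hs0]

lemma decayBound_nonneg (hp1 : 1 < p) {ρ : ℝ} (hρ : 0 < ρ) (hρ1 : ρ ≤ 1) :
    0 ≤ decayBound N p r ρ := by
  have : 0 ≤ Real.log (1 / ρ) := Real.log_nonneg ((one_le_div hρ).2 hρ1)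
  rw [decayBound_eq hp1]
  split_ifs <;> positivity

end Assembly

end SingularElliptic

/-! ### Conclusion: both decay estimates from the weight. -/

theorem corollary1p1 (N : ℕ) (hN : 3 ≤ N) (p r : ℝ)
    (hp : pCrit N < p) (hp' : p < pSobolev N) (hr : 0 < r) (hrp : r < p) :
    -- the limit `q = q_f` exists, and its Hölder conjugate `p_f` is `p`
    ∃ q : ℝ,
      Tendsto (fun s : ℝ => deriv (nonlin p r) s ^ 2 /
        (nonlin p r s * deriv (deriv (nonlin p r)) s)) atTop (𝓝 q) ∧
      1 / p + 1 / q = 1 ∧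
      ∃ r₀ ε : ℝ, 0 < r₀ ∧ 0 < ε ∧
        -- `ũ` is well defined on `(0, r₀]`
        (∀ ρ ∈ Ioc 0 r₀, ρ ^ 2 / (2 * (N : ℝ) - 4 * q) ∈ tailInt (nonlin p r) '' Ioi 0) ∧
        ∀ α β : ℝ, 0 < α → 0 < β → α + β < ε →
          ∃ (u : EuclideanSpace ℝ (Fin N) → ℝ) (θ : ℝ → ℝ),
            IsSingularSolution N (nonlin p r) r₀ u ∧
            (∀ x ∈ Metric.ball (0 : EuclideanSpace ℝ (Fin N)) r₀ \ {0},
              u x = uTilde N q (nonlin p r) ‖x‖ * (1 + θ ‖x‖)) ∧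
            ContDiffOn ℝ 2 θ (Ioo 0 r₀) ∧
            ContDiffOn ℝ 1 θ (Ioc 0 r₀) ∧
            ContinuousOn θ (Icc 0 r₀) ∧
            θ r₀ = α ∧
            r₀ * derivWithin θ (Ioc 0 r₀) r₀ = -β ∧
            (fun ρ : ℝ => |θ ρ| + ρ * |deriv θ ρ|) =O[𝓝[>] 0]
              (fun ρ : ℝ => ∫ s in ρ..r₀, kernelP N p ρ s *
                |deriv (nonlin p r) (uTilde N q (nonlin p r) s) *
                  tailInt (nonlin p r) (uTilde N q (nonlin p r) s) - q| / s) ∧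
            (fun ρ : ℝ => |θ ρ| + ρ * |deriv θ ρ|) =O[𝓝[>] 0] decayBound N p r := by

  have hp1 := one_lt_of_pCrit_lt hN hp
  have ha := coeffA_pos hN hp1 hp'
  obtain ⟨b, hb⟩ : ∃ b, b = 2 * (N : ℝ) - 4 * (p / (p - 1)) := ⟨_, rfl⟩
  have hb0 : 0 < b := hb ▸ two_mul_sub_pos hN hp
  have hl := kernelRate_pos hN hp hp'
  have hj : (0 : ℝ) ≤ kernelLogOrder N p := Nat.cast_nonneg _
  have hj1 : (kernelLogOrder N p : ℝ) ≤ 1 := kernelLogOrder_le_one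
  obtain ⟨k, k', C, hC, hk, hkK⟩ := exists_kernel_fundamentalSolution hN hp hp'
  rw [← hb] at hk
  obtain ⟨r₀, ε, c, M, ν, B, hr₀, hr₀1, hε, hc, hν, hB, hy₀, hHB, hsol⟩ :=
    exists_relative_perturbation hp1 hr hrp hb0 ha hj hj1 hl hC hk hkK
  refine ⟨p / (p - 1), tendsto_deriv_sq_div hp1 hrp, ?_, r₀, ε, hr₀, hε, ?_, ?_⟩
  · have h1 : p - 1 ≠ 0 := by linarith
    have h2 : p ≠ 0 := by linarith
    field_simp
    ring
  · intro ρ hρ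
    rw [← hb]
    refine mem_image_tailInt hp1 hrp (div_pos (pow_pos hρ.1 2) hb0) (le_trans ?_ hy₀.le)
    exact div_le_div_of_nonneg_right (pow_le_pow_left₀ hρ.1.le hρ.2 2) hb0.le
  intro α β hα hβ hαβ
  obtain ⟨θ, η, ζ, d1, d2, hζ, hθ0, hη0, hθ⟩ := hsol α β hα hβ hαβ
  have hθ2 := contDiff_two_of_hasDerivAt d1 d2 hζ
  set H : ℝ → ℝ := fun t => |holderDefect p r (profile p r b r₀ t)| with hH
  have hHc : Continuous H :=
    (continuous_holderDefect_comp hp1 (continuous_profile hp1 hrp hb0 hr₀ hy₀)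
      fun t => zero_lt_one.trans_le (one_le_profile hp1 hrp hb0 hr₀ hy₀ t)).abs
  have hH0 : ∀ t, 0 ≤ t → 0 ≤ H t := fun t _ => abs_nonneg _
  set A := decayWeight (kernelLogOrder N p) (kernelRate N p) c H with hA
  -- Since ρ d/dρ = -d/dt, the weighted radial derivative is |η|.
  have hsize : ∀ ρ ∈ Ioc 0 r₀, |radialPerturbation r₀ θ ρ| + ρ * |deriv (radialPerturbation r₀ θ) ρ| ≤
      M * A (Real.log (r₀ / ρ)) := by
    intro ρ hρ
    rw [(hasDerivAt_radialPerturbation d1 hr₀ hρ.1).deriv, abs_neg, abs_div, abs_of_pos hρ.1,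
      mul_div_cancel₀ _ hρ.1.ne', radialPerturbation, if_neg hρ.1.not_ge]
    exact (hθ _ (Real.log_nonneg ((one_le_div hρ.1).2 hρ.2))).2.2.2
  have hsize0 : ∀ ρ ∈ Ioc 0 r₀,
      0 ≤ |radialPerturbation r₀ θ ρ| + ρ * |deriv (radialPerturbation r₀ θ) ρ| := fun ρ hρ =>
    add_nonneg (abs_nonneg _) (mul_nonneg hρ.1.le (abs_nonneg _))
  have hAnn : ∀ ρ ∈ Ioc 0 r₀, 0 < A (Real.log (r₀ / ρ)) := fun ρ hρ =>
    decayWeight_pos hj hc hH0 (Real.log_nonneg ((one_le_div hρ.1).2 hρ.2))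
  have hmem : ∀ᶠ ρ in 𝓝[>] (0 : ℝ), ρ ∈ Ioc 0 r₀ := Ioc_mem_nhdsGT hr₀
  have hM : 0 ≤ M := by
    have h1 := (hsize0 r₀ ⟨hr₀, le_rfl⟩).trans (hsize r₀ ⟨hr₀, le_rfl⟩)
    exact nonneg_of_mul_nonneg_left h1 (hAnn r₀ ⟨hr₀, le_rfl⟩)
  refine ⟨fun x => radialSolution p r b r₀ θ (‖x‖ ^ 2), radialPerturbation r₀ θ,
    isSingularSolution_radialSolution hp1 hrp hb hb0 hr₀ hy₀ d1 d2 hζ (fun t ht => (hθ t ht).1)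
      (fun t ht => (hθ t ht).2.1), ?_,
    (contDiffOn_radialPerturbation hθ2 hr₀).mono Ioo_subset_Ioi_self,
    ((contDiffOn_radialPerturbation hθ2 hr₀).mono Ioc_subset_Ioi_self).of_le one_le_two,
    continuousOn_radialPerturbation hθ2 hr₀ hν (fun t ht => (hθ t ht).2.2.1), ?_, ?_, ?_, ?_⟩
  · intro x hx
    have hx0 : 0 < ‖x‖ := norm_pos_iff.2 fun h => hx.2 (by simp [h])
    change radialSolution p r b r₀ θ (‖x‖ ^ 2) = _
    rw [radialSolution, uTilde, ← hb, radialPerturbation, if_neg hx0.not_ge, Real.log_pow,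
      Real.log_div hr₀.ne' hx0.ne']
    push_cast
    rw [mul_div_cancel_left₀ _ two_ne_zero]
  · rw [radialPerturbation, if_neg hr₀.not_ge, div_self hr₀.ne', Real.log_one, hθ0]
  -- The logarithmic-time solution also exists for t < 0, so there is a two-sided derivative at r₀
  -- and the one-sided one is its restriction.
  · have h1 := (hasDerivAt_radialPerturbation d1 hr₀ hr₀).hasDerivWithinAt (s := Ioc 0 r₀)
    have h2 : UniqueDiffWithinAt ℝ (Ioc 0 r₀) r₀ :=
      (uniqueDiffOn_convex (convex_Ioc 0 r₀) (by simp [hr₀])) r₀ ⟨hr₀, le_rfl⟩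
    rw [h1.derivWithin h2, div_self hr₀.ne', Real.log_one, hη0]
    field_simp
  -- The kernel part of the weight comes from the initial data and is absent from the claimed bound;
  -- a nonzero defect at one time makes the convolution dominate it.
  · obtain ⟨t₀, ht₀, hne⟩ := exists_holderDefect_profile_ne_zero hp1 hr hrp hb0 hr₀ hy₀
    obtain ⟨C', hC', hev⟩ := exists_decayKernel_le_decayConv (j := kernelLogOrder N p) hj hl.le hHc
      hH0 ht₀ (abs_pos.2 hne)
    have htend : Tendsto (fun ρ => Real.log (r₀ / ρ)) (𝓝[>] 0) atTop :=
      Real.tendsto_log_atTop.comp (tendsto_inv_nhdsGT_zero.const_mul_atTop hr₀)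
    refine IsBigO.of_bound (M * (c * C' + 1)) ?_
    filter_upwards [hmem, htend.eventually hev] with ρ hρ hρ'
    have ht := Real.log_nonneg ((one_le_div hρ.1).2 hρ.2)
    rw [integral_kernelP_eq hp1 hrp hb hb0 hr₀ hy₀ hρ.1 hρ.2, Real.norm_eq_abs, Real.norm_eq_abs,
      abs_of_nonneg (hsize0 ρ hρ), abs_of_nonneg (decayConv_nonneg hj hH0 ht)]
    refine (hsize ρ hρ).trans ?_
    rw [mul_assoc]
    refine mul_le_mul_of_nonneg_left ?_ hM
    have := mul_le_mul_of_nonneg_left hρ' hc.le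
    rw [hA, decayWeight]
    linarith
  · obtain ⟨C', hev⟩ := decayWeight_isBigO_decayBound (N := N) hp1 hHc hr₀ hr₀1 hc.le hB hHB
    refine IsBigO.of_bound (M * C') ?_
    filter_upwards [hmem, hev] with ρ hρ hρ'
    rw [Real.norm_eq_abs, Real.norm_eq_abs, abs_of_nonneg (hsize0 ρ hρ),
      abs_of_nonneg (decayBound_nonneg hp1 hρ.1 (hρ.2.trans hr₀1))]
    refine (hsize ρ hρ).trans ?_
    rw [mul_assoc]
    exact mul_le_mul_of_nonneg_left hρ' hM
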